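/- **Setting.** All functions are complex valued. Let $M\ge 1$, $\lambda\in\mathbb{C}$, and let $P(x,\frac{d}{dx})=\sum_{m=0}^{M}p_m(x)\bigl(\frac{d}{dx}\bigr)^m$ be a linear differential operator with infinitely differentiable coefficients $p_m:\mathbb{R}\to\mathbb{C}$ (for example polynomials). Its set of singular points is $S=p_M^{-1}(0)$. A *Hilbert function space* is a Hilbert space whose elements are measurable functions on $\mathbb{R}$ (identified when equal almost everywhere), with the pointwise linear operations, such that if $u_k\to f$ in norm and $u_k\to g$ almost everywhere, then $f=g$ almost everywhere. A class is said to be $C^k$ if it has a $C^k$ representative, which is then used. Let $\mathcal{H}$ and $\mathcal{H}^\Diamond$ be Hilbert function spaces with $\mathcal{H}\subset\mathcal{H}^\Diamond$ as sets of functions (the inner products may be unrelated), with complete orthonormal systems $\{e_n\}_{n\ge 0}$ of $\mathcal{H}$ and $\{e_n^\Diamond\}_{n\ge 0}$ of $\mathcal{H}^\Diamond$. Inner products are linear in the first argument. Let $\widetilde A$ be the action of $P$ in $\mathcal{H}$ with domain $\{f\in C^M(\mathbb{R})\cap\mathcal{H} : Pf\in\mathcal{H}\}$, and $A$ its closure in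 the graph norm. Let $\widetilde B$ be the action of $P-\lambda I$ from $\mathcal{H}$ to $\mathcal{H}^\Diamond$ with domain $D(\widetilde B)=\{f\in C^M(\mathbb{R})\cap\mathcal{H} : (P-\lambda I)f\in\mathcal{H}^\Diamond\}$, and $B$ its closure in the graph norm. **Conditions.** Assume: - (C1) $e_n\in D(\widetilde B)$ for every $n$. Put $b_m^n=\langle Be_n,e_m^\Diamond\rangle_{\mathcal{H}^\Diamond}$. - (C2) There is an integer $\ell_0$ such that $b_m^n=0$ whenever $|n-m|>\ell_0$. - (C2$^+$) There is a positive function $\upsilon^\Diamond\in C^M(\mathbb{R})$ such that $\langle f,g\rangle_{\mathcal{H}^\Diamond}=\int_{\mathbb{R}}f(x)\overline{g(x)}\,\upsilon^\Diamond(x)\,dx$ for all $f,g\in\mathcal{H}^\Diamond$. - (C2.1) $\sup_{n\ge 1,\,m\ge 0}|b_m^n|/n^M<\infty$. - (C2.2) Every $e_n^\Diamond$ is in $C^M(\mathbb{R})$, and there are $n_1,n_0\in C^{M-1}(\mathbb{R})$ and real numbers $\lambda_n$ with $n_1(x)\frac{d}{dx}e_n^\Diamond(x)+n_0(x)e_n^\Diamond(x)=\lambda_n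 e_n^\Diamond(x)$ for all $n\ge 0$ and $x\in\mathbb{R}$, and $\liminf_{n\to\infty}|\lambda_n|/n>0$. - (C2.3) There is $\tilde a\in C^0(\mathbb{R})$ with $|e_n^\Diamond(x)|\le\tilde a(x)$ for all $n\ge 0$ and $x\in\mathbb{R}$. - (C3) There is a linear operator $C$ from a dense subspace $D(C)$ of $\mathcal{H}^\Diamond$ to $\mathcal{H}$ such that, for every $m$, $e_m^\Diamond\in D(C)$ and $\langle Bf,e_m^\Diamond\rangle_{\mathcal{H}^\Diamond}=\langle f,Ce_m^\Diamond\rangle_{\mathcal{H}}$ for all $f\in D(\widetilde B)$. **Theorem.** For every $f\in\mathcal{H}$ the implications (i) $\Rightarrow$ (ii) $\Rightarrow$ (iii) $\Rightarrow$ (iv) hold, where - (i) $f\in\operatorname{dom}A$ and $Af=\lambda f$; - (ii) $f\in\operatorname{dom}B$ and $Bf=0$; - (iii) the sequence $f_n=\langle f,e_n\rangle_{\mathcal{H}}$ is in $\ell^2$ and satisfies $\sum_{n=0}^\infty b_m^n f_n=0$ for every $m\ge 0$; - (iv) $f\in C^M(\mathbb{R}\setminus S)$ (after modification on a null set) and $P(x,\frac{d}{dx})f(x)=\lambda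 f(x)$ for every $x\in\mathbb{R}\setminus S$. -/

import Mathlib

open MeasureTheory Filter Topology
open scoped ContDiff

/-- A Hilbert space of (complex-valued, measurable) functions on the real line.  As usual, functions
that agree almost everywhere are identified, so that the elements of `H` are almost-everywhere
classes; the inner product of `H` is arbitrary.  The only link between norm and functions is that a
limit in norm and a pointwise almost everywhere limit of the same sequence are the same function. -/
class HilbertFunctionSpace (H : Type*) [NormedAddCommGroup H] [InnerProductSpace ℂ H] where
  /-- the function (class) which an element of `H` is -/
  toAE : H →ₗ[ℂ] (ℝ →ₘ[volume] ℂ)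
  toAE_injective : Function.Injective toAE
  ae_limit_eq : ∀ (u : ℕ → H) (f : H) (g : ℝ →ₘ[volume] ℂ),
    Tendsto u atTop (𝓝 f) →
    (∀ᵐ x : ℝ, Tendsto (fun k => (toAE (u k) : ℝ → ℂ) x) atTop (𝓝 (g x))) →
    toAE f = g

/-- A linear differential operator `∑ m ≤ M, p_m(x) (d/dx)^m` on the real line, with
infinitely differentiable complex-valued coefficient functions. -/
structure LinDiffOp (M : ℕ) where
  coeff : Fin (M + 1) → ℝ → ℂ
  smooth : ∀ m, ContDiff ℝ ∞ (coeff m)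

namespace LinDiffOp

variable {M : ℕ}

/-- The action of the differential operator on a function. -/
noncomputable def act (P : LinDiffOp M) (u : ℝ → ℂ) (x : ℝ) : ℂ :=
  ∑ m : Fin (M + 1), P.coeff m x * iteratedDeriv (m : ℕ) u x

/-- The differential operator `P - lam I`. -/
def shift (P : LinDiffOp M) (lam : ℂ) : LinDiffOp M where
  coeff m x := P.coeff m x - if m = 0 then lam else 0
  smooth m := (P.smooth m).sub contDiff_const

/-- The set of singular points: the zeros of the leading coefficient `p_M`. -/
def singularSet (P : LinDiffOp M) : Set ℝ :=
  {x | P.coeff (Fin.last M) x = 0}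

theorem act_shift (P : LinDiffOp M) (lam : ℂ) (u : ℝ → ℂ) (x : ℝ) :
    (P.shift lam).act u x = P.act u x - lam * u x := by
  simp [act, shift, sub_mul, Finset.sum_sub_distrib]

theorem act_add (P : LinDiffOp M) {u v : ℝ → ℂ} (hu : ContDiff ℝ M u) (hv : ContDiff ℝ M v) :
    P.act (u + v) = P.act u + P.act v := by
  funext x
  simp only [act, Pi.add_apply, ← Finset.sum_add_distrib]
  refine Finset.sum_congr rfl fun m _ => ?_
  have hm : ((m : ℕ) : WithTop ℕ∞) ≤ (M : WithTop ℕ∞) := by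
    exact_mod_cast Nat.lt_succ_iff.mp m.2
  rw [iteratedDeriv_add (hu.of_le hm).contDiffAt (hv.of_le hm).contDiffAt, mul_add]

theorem act_smul (P : LinDiffOp M) (c : ℂ) {u : ℝ → ℂ} (hu : ContDiff ℝ M u) :
    P.act (c • u) = c • P.act u := by
  funext x
  simp only [act, Pi.smul_apply, Finset.smul_sum]
  refine Finset.sum_congr rfl fun m _ => ?_
  have hm : ((m : ℕ) : WithTop ℕ∞) ≤ (M : WithTop ℕ∞) := by
    exact_mod_cast Nat.lt_succ_iff.mp m.2
  rw [iteratedDeriv_const_smul (hu.of_le hm).contDiffAt c, smul_eq_mul, smul_eq_mul]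
  ring

theorem act_zero (P : LinDiffOp M) : P.act 0 = 0 := by
  simpa using P.act_smul (0 : ℂ) (contDiff_const (c := (0 : ℂ)) : ContDiff ℝ M fun _ : ℝ => (0 : ℂ))

end LinDiffOp

section Spaces

variable {M : ℕ}
variable {H : Type*} [NormedAddCommGroup H] [InnerProductSpace ℂ H] [HilbertFunctionSpace H]
variable {K : Type*} [NormedAddCommGroup K] [InnerProductSpace ℂ K] [HilbertFunctionSpace K]

open HilbertFunctionSpace

/-- `f` is the function `u`, and `u` is of class `C^M` on the real line.  (Such a `u` is unique.) -/
def IsCRep (M : ℕ) (f : H) (u : ℝ → ℂ) : Prop :=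
  ContDiff ℝ M u ∧ (toAE f : ℝ → ℂ) =ᵐ[volume] u

/-- The inclusion of `H` in `K` as sets of functions. -/
def FunctionSubset (H K : Type*) [NormedAddCommGroup H] [InnerProductSpace ℂ H]
    [HilbertFunctionSpace H] [NormedAddCommGroup K] [InnerProductSpace ℂ K]
    [HilbertFunctionSpace K] : Prop :=
  ∀ f : H, ∃ g : K, toAE g = toAE f

/-- The set of pairs `(f, P f)` with `f ∈ C^M(ℝ) ∩ H` and `P f ∈ K`. -/
def actionGraph (P : LinDiffOp M) (H K : Type*) [NormedAddCommGroup H] [InnerProductSpace ℂ H]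
    [HilbertFunctionSpace H] [NormedAddCommGroup K] [InnerProductSpace ℂ K]
    [HilbertFunctionSpace K] : Submodule ℂ (H × K) where
  carrier := {q | ∃ u : ℝ → ℂ, IsCRep M q.1 u ∧ (toAE q.2 : ℝ → ℂ) =ᵐ[volume] P.act u}
  add_mem' := by
    rintro ⟨f, g⟩ ⟨f', g'⟩ ⟨u, ⟨hu, hfu⟩, hgu⟩ ⟨v, ⟨hv, hfv⟩, hgv⟩
    refine ⟨u + v, ⟨hu.add hv, ?_⟩, ?_⟩
    · simp only [Prod.mk_add_mk, map_add]
      exact (AEEqFun.coeFn_add _ _).trans (hfu.add hfv)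
    · simp only [Prod.mk_add_mk, map_add]
      rw [P.act_add hu hv]
      exact (AEEqFun.coeFn_add _ _).trans (hgu.add hgv)
  zero_mem' := by
    refine ⟨0, ⟨contDiff_const, ?_⟩, ?_⟩
    · simpa using (AEEqFun.coeFn_zero (α := ℝ) (β := ℂ) (μ := volume))
    · rw [P.act_zero]
      simpa using (AEEqFun.coeFn_zero (α := ℝ) (β := ℂ) (μ := volume))
  smul_mem' := by
    rintro c ⟨f, g⟩ ⟨u, ⟨hu, hfu⟩, hgu⟩
    refine ⟨c • u, ⟨contDiff_const.smul hu, ?_⟩, ?_⟩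
    · simp only [Prod.smul_mk, map_smul]
      exact (AEEqFun.coeFn_smul _ _).trans (hfu.const_smul c)
    · simp only [Prod.smul_mk, map_smul]
      rw [P.act_smul c hu]
      exact (AEEqFun.coeFn_smul _ _).trans (hgu.const_smul c)

theorem actionGraph_functional (P : LinDiffOp M) :
    ∀ q ∈ actionGraph P H K, q.1 = 0 → q.2 = 0 := by
  rintro ⟨f, g⟩ ⟨u, ⟨hu, hfu⟩, hgu⟩ h0
  simp only at h0 hfu hgu ⊢
  subst h0
  have h1 : u =ᵐ[volume] (0 : ℝ → ℂ) := by
    refine hfu.symm.trans ?_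
    rw [map_zero]
    exact AEEqFun.coeFn_zero
  have h2 : u = 0 := Continuous.ae_eq_iff_eq volume hu.continuous continuous_const |>.mp h1
  rw [h2, P.act_zero] at hgu
  apply toAE_injective
  rw [map_zero]
  exact AEEqFun.ext (hgu.trans AEEqFun.coeFn_zero.symm)

/-- The action of `P` as an unbounded operator from `H` to `K`, with domain
`{f ∈ C^M(ℝ) ∩ H | P f ∈ K}`. -/
noncomputable def actionOp (P : LinDiffOp M) (H K : Type*) [NormedAddCommGroup H]
    [InnerProductSpace ℂ H] [HilbertFunctionSpace H] [NormedAddCommGroup K]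
    [InnerProductSpace ℂ K] [HilbertFunctionSpace K] : H →ₗ.[ℂ] K :=
  (actionGraph P H K).toLinearPMap

theorem actionOp_graph (P : LinDiffOp M) : (actionOp P H K).graph = actionGraph P H K :=
  Submodule.toLinearPMap_graph_eq _ (actionGraph_functional P)

/-- `Ã_{P,H}`. -/
noncomputable def opATilde (P : LinDiffOp M) (H : Type*) [NormedAddCommGroup H]
    [InnerProductSpace ℂ H] [HilbertFunctionSpace H] : H →ₗ.[ℂ] H :=
  actionOp P H H

/-- `A_{P,H}`, the closure of `Ã_{P,H}` in the graph norm. -/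
noncomputable def opA (P : LinDiffOp M) (H : Type*) [NormedAddCommGroup H]
    [InnerProductSpace ℂ H] [HilbertFunctionSpace H] : H →ₗ.[ℂ] H :=
  (opATilde P H).closure

/-- `B̃_{P,lam,H,K}`: the action of `P - lam I` from `H` to `K`. -/
noncomputable def opBTilde (P : LinDiffOp M) (lam : ℂ) (H K : Type*) [NormedAddCommGroup H]
    [InnerProductSpace ℂ H] [HilbertFunctionSpace H] [NormedAddCommGroup K]
    [InnerProductSpace ℂ K] [HilbertFunctionSpace K] : H →ₗ.[ℂ] K :=
  actionOp (P.shift lam) H K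

/-- `B_{P,lam,H,K}`, the closure of `B̃_{P,lam,H,K}` in the graph norm. -/
noncomputable def opB (P : LinDiffOp M) (lam : ℂ) (H K : Type*) [NormedAddCommGroup H]
    [InnerProductSpace ℂ H] [HilbertFunctionSpace H] [NormedAddCommGroup K]
    [InnerProductSpace ℂ K] [HilbertFunctionSpace K] : H →ₗ.[ℂ] K :=
  (opBTilde P lam H K).closure

theorem mem_opB_of_mem_opBTilde (P : LinDiffOp M) (lam : ℂ) {f : H}
    (hf : f ∈ (opBTilde P lam H K).domain) : f ∈ (opB P lam H K).domain :=
  (opBTilde P lam H K).le_closure.1 hf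

/-- C1: every `e_n` belongs to the domain of `B̃`. -/
def CondC1 (P : LinDiffOp M) (lam : ℂ) (e : HilbertBasis ℕ ℂ H) (K : Type*)
    [NormedAddCommGroup K] [InnerProductSpace ℂ K] [HilbertFunctionSpace K] : Prop :=
  ∀ n, e n ∈ (opBTilde P lam H K).domain

/-- The matrix elements `b_m^n = ⟨B e_n, e_m^◇⟩`.  (Here `⟨f, g⟩` is linear in `f`; Mathlib's
`inner` is linear in the second argument, so `⟨f, g⟩ = inner ℂ g f`.) -/
noncomputable def matrixElem (P : LinDiffOp M) (lam : ℂ) (e : HilbertBasis ℕ ℂ H)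
    (e' : HilbertBasis ℕ ℂ K) (h1 : CondC1 P lam e K) (m n : ℕ) : ℂ :=
  inner ℂ (e' m) (opB P lam H K ⟨e n, mem_opB_of_mem_opBTilde P lam (h1 n)⟩)

/-- C2: the matrix is band-diagonal. -/
def CondC2 (b : ℕ → ℕ → ℂ) : Prop :=
  ∃ l0 : ℤ, ∀ m n : ℕ, l0 < |(n : ℤ) - (m : ℤ)| → b m n = 0

/-- C2⁺: the inner product of `K` is a weighted `L²` inner product. -/
def CondC2Plus (M : ℕ) (K : Type*) [NormedAddCommGroup K] [InnerProductSpace ℂ K]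
    [HilbertFunctionSpace K] : Prop :=
  ∃ w : ℝ → ℝ, ContDiff ℝ M w ∧ (∀ x, 0 < w x) ∧ ∀ f g : K,
    Integrable (fun x : ℝ => (toAE f : ℝ → ℂ) x * star ((toAE g : ℝ → ℂ) x) * (w x : ℂ)) ∧
    inner ℂ g f = ∫ x : ℝ, (toAE f : ℝ → ℂ) x * star ((toAE g : ℝ → ℂ) x) * (w x : ℂ)

/-- C2.1: `|b_m^n| / n^M` is bounded, uniformly in `n ≥ 1` and `m`. -/
def CondC21 (M : ℕ) (b : ℕ → ℕ → ℂ) : Prop :=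
  ∃ c : ℝ, ∀ m n : ℕ, 1 ≤ n → ‖b m n‖ / (n : ℝ) ^ M ≤ c

/-- C2.2: the `e_n^◇` are of class `C^M` and are eigenfunctions of a first-order operator
`n₁(x) d/dx + n₀(x)` whose eigenvalues are real and grow at least linearly in modulus. -/
def CondC22 (M : ℕ) (e' : HilbertBasis ℕ ℂ K) : Prop :=
  ∃ (n1 n0 : ℝ → ℂ) (ev : ℕ → ℝ),
    ContDiff ℝ ((M - 1 : ℕ) : WithTop ℕ∞) n1 ∧ ContDiff ℝ ((M - 1 : ℕ) : WithTop ℕ∞) n0 ∧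
    (∀ n, ∃ u : ℝ → ℂ, IsCRep M (e' n) u ∧
      ∀ x, n1 x * deriv u x + n0 x * u x = (ev n : ℂ) * u x) ∧
    (0 : EReal) < liminf (fun n : ℕ => ((|ev n| / (n : ℝ) : ℝ) : EReal)) atTop

/-- C2.3: the `e_n^◇` have a common continuous envelope. -/
def CondC23 (M : ℕ) (e' : HilbertBasis ℕ ℂ K) : Prop :=
  ∃ a : ℝ → ℝ, Continuous a ∧
    ∀ n, ∃ u : ℝ → ℂ, IsCRep M (e' n) u ∧ ∀ x, ‖u x‖ ≤ a x

/-- C3: there is a densely defined linear operator `C` from `K` to `H` whose domain contains the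
`e_m^◇` and for which `⟨B f, e_m^◇⟩ = ⟨f, C e_m^◇⟩` on the domain of `B̃`. -/
def CondC3 (P : LinDiffOp M) (lam : ℂ) (H : Type*) [NormedAddCommGroup H]
    [InnerProductSpace ℂ H] [HilbertFunctionSpace H] (e' : HilbertBasis ℕ ℂ K) : Prop :=
  ∃ C : K →ₗ.[ℂ] H, Dense (C.domain : Set K) ∧
    ∀ m, ∃ hm : e' m ∈ C.domain, ∀ (f : H) (hf : f ∈ (opBTilde P lam H K).domain),
      inner ℂ (e' m) (opB P lam H K ⟨f, mem_opB_of_mem_opBTilde P lam hf⟩)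
        = inner ℂ (C ⟨e' m, hm⟩) f

/-- The space `V` of sequences with `∑ n, b_m^n f_n = 0` for all `m`. -/
def solutionSpace (b : ℕ → ℕ → ℂ) : Set (ℕ → ℂ) :=
  {s | ∀ m, HasSum (fun n => b m n * s n) 0}

end Spaces

/-! Testing against smooth compactly supported functions turns every statement about `P` into an
identity with the formal transpose. On a weighted `L²` space such tests are bounded functionals
(`IsWeight.exists_integral_mul_eq_inner`), so these identities survive graph closure. This makes the
operators closable and, with the automatic continuity of the inclusion
(`IsWeight.exists_inclusion`), gives (i) ⇒ (ii). For (ii) ⇒ (iii), C3 makes `f ↦ ⟨B f, e_m^◇⟩`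
bounded, and Parseval expands it along the matrix rows.

The heart is (iii) ⇒ (iv). Let `f_N` be the partial sums of `f` and `φ` a test function. The
integrals of `(P - lam) f_N` against `φ` tend to `L`, the integral of `f` against the transpose
applied to `φ`. By the band structure and the linear system, only rows `m` near `N` contribute. The
first-order eigenvalue equation can be transposed `M - 1` times, so the coefficients of `φ` are `O(m
^ -(M - 1))` times a square-summable sequence. Since the matrix grows like `n ^ M`, the contribution
is at most `N` times a summable sequence. If `L ≠ 0`, that sequence would dominate the harmonic
series; hence `L = 0` (`eq_zero_of_tendsto_truncation`) and `f` is a weak solution.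

Away from the zeros of `p_M`, weak solutions are classical: repeated integration reduces the order
of the weak equation and shows that the leading product gains a derivative; division by the leading
coefficient closes the bootstrap (`AERegularOn.of_weak_solution`,
`LinDiffOp.exists_solution_of_weak`). -/

/-! ### Test functions and integration by parts. -/

/-- Complex-valued smooth functions with compact support in `I`. -/
structure IsTestFunction (I : Set ℝ) (φ : ℝ → ℂ) : Prop where
  smooth : ContDiff ℝ ∞ φ
  compact : HasCompactSupport φ
  support : tsupport φ ⊆ I

namespace IsTestFunction

variable {I J : Set ℝ} {φ ψ : ℝ → ℂ}

theorem mono (h : IsTestFunction I φ) (hIJ : I ⊆ J) : IsTestFunction J φ :=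
  ⟨h.smooth, h.compact, h.support.trans hIJ⟩

theorem deriv (h : IsTestFunction I φ) : IsTestFunction I (deriv φ) := by
  refine ⟨?_, h.compact.deriv, (closure_mono support_deriv_subset).trans ?_⟩
  · exact (contDiff_infty_iff_deriv.mp h.smooth).2
  · simpa [tsupport] using h.support

theorem iteratedDeriv (h : IsTestFunction I φ) (m : ℕ) :
    IsTestFunction I (iteratedDeriv m φ) := by
  induction m with
  | zero => simpa using h
  | succ m ih => rw [iteratedDeriv_succ]; exact ih.deriv

theorem smooth_mul (h : IsTestFunction I φ) {q : ℝ → ℂ} (hq : ContDiff ℝ ∞ q) :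
    IsTestFunction I (fun x => q x * φ x) :=
  ⟨hq.mul h.smooth, h.compact.mul_left, (tsupport_mul_subset_right (f := q)).trans h.support⟩

theorem sub (h : IsTestFunction I φ) (h' : IsTestFunction I ψ) :
    IsTestFunction I (fun x => φ x - ψ x) :=
  ⟨h.smooth.sub h'.smooth, h.compact.sub h'.compact,
    (tsupport_sub φ ψ).trans (Set.union_subset h.support h'.support)⟩

theorem ofReal {g : ℝ → ℝ} (hg : ContDiff ℝ ∞ g) (hc : HasCompactSupport g)
    (hs : tsupport g ⊆ I) : IsTestFunction I (fun x => (g x : ℂ)) :=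
  ⟨Complex.ofRealCLM.contDiff.comp hg, hc.comp_left (g := fun y : ℝ => (y : ℂ)) (by simp),
    (closure_mono (fun x hx => by
      simpa using hx)).trans hs⟩

theorem continuous (h : IsTestFunction I φ) : Continuous φ := h.smooth.continuous

theorem integrable_mul (h : IsTestFunction I φ) {g : ℝ → ℂ} (hg : LocallyIntegrable g) :
    Integrable (fun x => g x * φ x) :=
  hg.integrable_smul_right_of_hasCompactSupport h.continuous h.compact

theorem integrable (h : IsTestFunction I φ) : Integrable φ :=
  h.continuous.integrable_of_hasCompactSupport h.compact

theorem integral_deriv (h : IsTestFunction I φ) : ∫ x, _root_.deriv φ x = 0 :=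
  integral_eq_zero_of_hasDerivAt_of_integrable
    (fun x => (h.smooth.differentiable (by simp)).differentiableAt.hasDerivAt)
    h.deriv.integrable h.integrable

end IsTestFunction

/-- A locally integrable function which annihilates all test functions on an open set vanishes
almost everywhere there. -/
theorem ae_eq_zero_of_integral_mul_testFunction {I : Set ℝ} (hI : IsOpen I) {g : ℝ → ℂ}
    (hg : LocallyIntegrable g) (h : ∀ φ, IsTestFunction I φ → ∫ x, g x * φ x = 0) :
    ∀ᵐ x, x ∈ I → g x = 0 := by
  refine hI.ae_eq_zero_of_integral_contDiff_smul_eq_zero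
    (hg.locallyIntegrableOn I) fun φ h1 h2 h3 => ?_
  rw [← h _ (IsTestFunction.ofReal h1 h2 h3)]
  refine integral_congr_ae (Eventually.of_forall fun x => ?_)
  simp [mul_comm]

/-- Integration by parts, one of the factors having compact support. -/
theorem integral_deriv_mul_of_hasCompactSupport {u φ : ℝ → ℂ} (hu : ContDiff ℝ 1 u)
    (hφ : ContDiff ℝ 1 φ) (hc : HasCompactSupport φ) :
    ∫ x, deriv u x * φ x = -∫ x, u x * deriv φ x := by
  have hu' : Continuous (deriv u) := hu.continuous_deriv le_rfl
  have hφ' : Continuous (deriv φ) := hφ.continuous_deriv le_rfl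
  rw [integral_mul_deriv_eq_deriv_mul_of_integrable (u := u) (v := φ) (u' := deriv u)
    (v' := deriv φ)
    (fun x _ => (hu.differentiable one_ne_zero).differentiableAt.hasDerivAt)
    (fun x _ => (hφ.differentiable one_ne_zero).differentiableAt.hasDerivAt)]
  · simp
  · exact (hu.continuous.mul hφ').integrable_of_hasCompactSupport hc.deriv.mul_left
  · exact (hu'.mul hφ.continuous).integrable_of_hasCompactSupport hc.mul_left
  · exact (hu.continuous.mul hφ.continuous).integrable_of_hasCompactSupport hc.mul_left

theorem integral_iteratedDeriv_mul_testFunction (m : ℕ) {u : ℝ → ℂ} (hu : ContDiff ℝ m u)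
    {φ : ℝ → ℂ} {I : Set ℝ} (hφ : IsTestFunction I φ) :
    ∫ x, iteratedDeriv m u x * φ x = (-1) ^ m * ∫ x, u x * iteratedDeriv m φ x := by
  induction m generalizing φ with
  | zero => simp
  | succ m ih =>
    have h1 : ContDiff ℝ 1 (iteratedDeriv m u) := by
      rw [iteratedDeriv_eq_iterate]
      exact ContDiff.iterate_deriv' 1 m (by rw [add_comm]; exact_mod_cast hu)
    rw [iteratedDeriv_succ, integral_deriv_mul_of_hasCompactSupport h1
      (hφ.smooth.of_le (by exact_mod_cast le_top)) hφ.compact, ih (hu.of_le (by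
        exact_mod_cast m.le_succ)) hφ.deriv, iteratedDeriv_succ', pow_succ]
    ring

/-- Integration by parts for the primitive of a locally integrable function. -/
theorem integral_mul_testFunction_eq_neg_primitive {g : ℝ → ℂ} (hg : LocallyIntegrable g) (c : ℝ)
    {I : Set ℝ} {φ : ℝ → ℂ} (hφ : IsTestFunction I φ) :
    ∫ x, g x * φ x = -∫ x, (∫ t in c..x, g t) * deriv φ x := by
  obtain ⟨a, b, hab⟩ : ∃ a b, tsupport φ ⊆ Set.Ioc a b := by
    obtain ⟨r, hr⟩ := hφ.compact.isBounded.subset_ball 0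
    refine ⟨-r, r, hr.trans fun x hx => ?_⟩
    simp only [Metric.mem_ball, dist_zero_right, Real.norm_eq_abs, abs_lt] at hx
    exact ⟨hx.1, hx.2.le⟩
  have hint : ∀ x y, IntervalIntegrable g volume x y := fun x y => (hg.integrableOn_isCompact isCompact_uIcc).intervalIntegrable
  set g1 : ℝ → ℂ := (Set.Ioc a b).indicator g with hg1
  have hg1i : Integrable g1 := by
    rw [hg1, integrable_indicator_iff measurableSet_Ioc]
    exact (hg.integrableOn_isCompact isCompact_Icc).mono_set Set.Ioc_subset_Icc_self
  -- Fubini on the triangle `t < x`: integrating in `x` first yields `-g φ`, in `t` first the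
  -- primitive based at `a`. Cutting `g` off to `g1` makes the integrand integrable on the plane.
  set F : ℝ → ℝ → ℂ := fun t x => (Set.Iio x).indicator (fun t => g1 t * deriv φ x) t with hF
  have hFi : Integrable (Function.uncurry F) (volume.prod volume) := by
    have h1 : Integrable (fun z : ℝ × ℝ => g1 z.1 * deriv φ z.2) (volume.prod volume) :=
      hg1i.mul_prod hφ.deriv.integrable
    have h2 : Function.uncurry F = {z : ℝ × ℝ | z.1 < z.2}.indicator
        (fun z : ℝ × ℝ => g1 z.1 * deriv φ z.2) := by
      funext ⟨t, x⟩
      simp [hF, Function.uncurry, Set.indicator_apply]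
    rw [h2]
    exact h1.indicator (measurableSet_lt measurable_fst measurable_snd)
  have hswap := integral_integral_swap hFi
  have hzero : ∀ x, x ∉ Set.Ioc a b → φ x = 0 := fun x hx =>
    image_eq_zero_of_notMem_tsupport fun h => hx (hab h)
  have hzero' : ∀ x, x ∉ Set.Ioc a b → deriv φ x = 0 := fun x hx =>
    deriv_of_notMem_tsupport fun h => hx (hab h)
  have hl : ∀ t, ∫ x, F t x = -(g t * φ t) := by
    intro t
    have h1 : F t = (Set.Ioi t).indicator (fun x => g1 t * deriv φ x) := by
      funext x
      simp [hF, Set.indicator_apply]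
    rw [h1, integral_indicator measurableSet_Ioi, integral_const_mul,
      hφ.compact.integral_Ioi_deriv_eq (hφ.smooth.of_le (by exact_mod_cast le_top))]
    by_cases ht : t ∈ Set.Ioc a b
    · simp [hg1, ht]
    · simp [hzero t ht]
  have hr : ∀ x, ∫ t, F t x = (∫ t in a..x, g t) * deriv φ x := by
    intro x
    by_cases hx : x ∈ Set.Ioc a b
    · simp only [hF]
      rw [integral_indicator measurableSet_Iio, integral_mul_const, hg1,
        setIntegral_indicator measurableSet_Ioc, intervalIntegral.integral_of_le hx.1.le,
        integral_Ioc_eq_integral_Ioo]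
      congr 3
      ext t
      simp only [Set.mem_inter_iff, Set.mem_Iio, Set.mem_Ioc, Set.mem_Ioo]
      exact ⟨fun h => ⟨h.2.1, h.1⟩, fun h => ⟨h.2, h.1, h.2.le.trans hx.2⟩⟩
    · simp [hF, hzero' x hx]
  simp only [hl, hr, integral_neg] at hswap
  -- Moving the base point from `a` to `c` adds a constant to the primitive, which `φ'` annihilates.
  have hsplit : ∀ x, (∫ t in c..x, g t) * deriv φ x
      = (∫ t in c..a, g t) * deriv φ x + (∫ t in a..x, g t) * deriv φ x := fun x => by
    rw [← add_mul, intervalIntegral.integral_add_adjacent_intervals (hint c a) (hint a x)]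
  have hcont : Continuous fun x => ∫ t in a..x, g t :=
    intervalIntegral.continuous_primitive hint a
  rw [integral_congr_ae (Eventually.of_forall hsplit), integral_add (hφ.deriv.integrable.const_mul _)
    (hφ.deriv.integrable_mul hcont.locallyIntegrable), integral_const_mul, hφ.integral_deriv,
    ← hswap]
  rw [mul_zero, zero_add, neg_neg]

/-- On `Ioo a b`, a linear functional on test functions which annihilates all derivatives is a
multiple of the integral. -/
theorem exists_eq_const_mul_integral_of_annihilates_deriv {a b : ℝ} (hab : a < b)
    (T : (ℝ → ℂ) → ℂ)
    (hsub : ∀ φ ψ, IsTestFunction (Set.Ioo a b) φ → IsTestFunction (Set.Ioo a b) ψ →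
      T (fun x => φ x - ψ x) = T φ - T ψ)
    (hmul : ∀ (c : ℂ) φ, IsTestFunction (Set.Ioo a b) φ → T (fun x => c * φ x) = c * T φ)
    (hderiv : ∀ φ, IsTestFunction (Set.Ioo a b) φ → T (deriv φ) = 0) :
    ∃ c, ∀ φ, IsTestFunction (Set.Ioo a b) φ → T φ = c * ∫ x, φ x := by
  obtain ⟨ψ, hψ, hψ1⟩ : ∃ ψ, IsTestFunction (Set.Ioo a b) ψ ∧ ∫ x, ψ x = 1 := by
    let β : ContDiffBump ((a + b) / 2) :=
      ⟨(b - a) / 8, (b - a) / 4, by linarith, by linarith⟩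
    refine ⟨fun x => (β.normed volume x : ℂ),
      IsTestFunction.ofReal β.contDiff_normed β.hasCompactSupport_normed ?_, ?_⟩
    · rw [β.tsupport_normed_eq]
      intro x hx
      rw [Metric.mem_closedBall, Real.dist_eq, abs_le] at hx
      change -((b - a) / 4) ≤ _ ∧ _ ≤ (b - a) / 4 at hx
      constructor <;> linarith [hx.1, hx.2]
    · rw [integral_complex_ofReal, β.integral_normed]; simp
  refine ⟨T ψ, fun φ hφ => ?_⟩
  set s : ℂ := ∫ x, φ x with hs
  have hsψ : IsTestFunction (Set.Ioo a b) (fun x => s * ψ x) := hψ.smooth_mul contDiff_const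
  -- Subtracting the multiple of `ψ` with the same integral leaves mean zero, so `χ` is the
  -- derivative of a test function and `T χ = 0`.
  set χ : ℝ → ℂ := fun x => φ x - s * ψ x with hχ
  have hχt : IsTestFunction (Set.Ioo a b) χ := hφ.sub hsψ
  have hχ0 : ∫ x, χ x = 0 := by
    rw [hχ, integral_sub hφ.integrable hsψ.integrable, integral_const_mul, hψ1, mul_one, sub_self]
  obtain ⟨a', b', ha', hb', hsupp⟩ : ∃ a' b', a < a' ∧ b' < b ∧ tsupport χ ⊆ Set.Icc a' b' := by
    -- The midpoint is inserted only to have a nonempty compact set when `χ = 0`.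
    have hK : IsCompact (insert ((a + b) / 2) (tsupport χ)) := hχt.compact.isCompact.insert _
    have hKs : insert ((a + b) / 2) (tsupport χ) ⊆ Set.Ioo a b :=
      Set.insert_subset ⟨by linarith, by linarith⟩ hχt.support
    obtain ⟨x, hx⟩ := hK.exists_isLeast (Set.insert_nonempty _ _)
    obtain ⟨y, hy⟩ := hK.exists_isGreatest (Set.insert_nonempty _ _)
    exact ⟨x, y, (hKs hx.1).1, (hKs hy.1).2, fun z hz =>
      ⟨hx.2 (Set.mem_insert_of_mem _ hz), hy.2 (Set.mem_insert_of_mem _ hz)⟩⟩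
  have hzero : ∀ x, x ∉ Set.Icc a' b' → χ x = 0 := fun x hx =>
    image_eq_zero_of_notMem_tsupport fun h => hx (hsupp h)
  set Φ : ℝ → ℂ := fun x => ∫ t in Set.Iic x, χ t with hΦ
  have hΦd : ∀ x, HasDerivAt Φ (χ x) x := by
    intro x
    have h1 : Φ = fun y => (∫ t in Set.Iic x, χ t) + ∫ t in x..y, χ t := by
      funext y
      rw [← intervalIntegral.integral_Iic_sub_Iic hχt.integrable.integrableOn
        hχt.integrable.integrableOn]
      simp [hΦ]
    rw [h1]
    exact ((hχt.continuous.integral_hasStrictDerivAt x x).hasDerivAt).const_add _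
  have hΦ' : deriv Φ = χ := funext fun x => (hΦd x).deriv
  have hΦsupp : Function.support Φ ⊆ Set.Icc a' b' := by
    intro x hx
    by_contra hx'
    apply hx
    rw [Set.mem_Icc, not_and_or, not_le, not_le] at hx'
    rcases hx' with h | h
    · refine setIntegral_eq_zero_of_forall_eq_zero fun t ht => hzero t fun h' => ?_
      exact absurd (h'.1.trans ht) (not_le.mpr h)
    · simp only [hΦ]
      rw [setIntegral_eq_integral_of_forall_compl_eq_zero fun t ht => hzero t fun h' => ?_, hχ0]
      exact ht (h'.2.trans h.le)
  have hΦt : IsTestFunction (Set.Ioo a b) Φ := by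
    refine ⟨contDiff_infty_iff_deriv.mpr ⟨fun x => (hΦd x).differentiableAt, ?_⟩,
      HasCompactSupport.of_support_subset_isCompact isCompact_Icc hΦsupp,
      (closure_minimal hΦsupp isClosed_Icc).trans
        fun x hx => ⟨ha'.trans_le hx.1, hx.2.trans_lt hb'⟩⟩
    rw [hΦ']; exact hχt.smooth
  have h0 := hderiv Φ hΦt
  rw [hΦ', hχ, hsub φ _ hφ hsψ, hmul s ψ hψ, sub_eq_zero] at h0
  rw [h0, mul_comm]

/-! ### Interior regularity by bootstrapping. -/

/-- Regularity, up to modification on a null set, on an open set `I`: no condition for `k = 0`, and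
class `C^(k-1)` for `k ≥ 1`. -/
def AERegularOn (I : Set ℝ) : ℕ → (ℝ → ℂ) → Prop
  | 0, _ => True
  | k + 1, g => ∃ v : ℝ → ℂ, ContDiffOn ℝ k v I ∧ ∀ᵐ x, x ∈ I → g x = v x

namespace AERegularOn

variable {I : Set ℝ} {k : ℕ} {g h : ℝ → ℂ}

theorem of_succ (hg : AERegularOn I (k + 1) g) : AERegularOn I k g := by
  cases k with
  | zero => trivial
  | succ k =>
    obtain ⟨v, hv, hgv⟩ := hg
    exact ⟨v, hv.of_le (by exact_mod_cast k.le_succ), hgv⟩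

theorem sub (hg : AERegularOn I k g) (hh : AERegularOn I k h) :
    AERegularOn I k (fun x => g x - h x) := by
  cases k with
  | zero => trivial
  | succ k =>
    obtain ⟨v, hv, hgv⟩ := hg
    obtain ⟨w, hw, hhw⟩ := hh
    refine ⟨fun x => v x - w x, hv.sub hw, ?_⟩
    filter_upwards [hgv, hhw] with x h1 h2 hx
    rw [h1 hx, h2 hx]

theorem mul_contDiffOn (hg : AERegularOn I k g) {q : ℝ → ℂ} (hq : ContDiffOn ℝ ∞ q I) :
    AERegularOn I k (fun x => g x * q x) := by
  cases k with
  | zero => trivial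
  | succ k =>
    obtain ⟨v, hv, hgv⟩ := hg
    refine ⟨fun x => v x * q x, hv.mul (hq.of_le (by exact_mod_cast le_top)), ?_⟩
    filter_upwards [hgv] with x h1 hx
    rw [h1 hx]

theorem congr_ae (hg : AERegularOn I k g) (hgh : ∀ᵐ x, x ∈ I → h x = g x) :
    AERegularOn I k h := by
  cases k with
  | zero => trivial
  | succ k =>
    obtain ⟨v, hv, hgv⟩ := hg
    refine ⟨v, hv, ?_⟩
    filter_upwards [hgv, hgh] with x h1 h2 hx
    rw [h2 hx, h1 hx]

/-- A primitive of a locally integrable function is continuous, which is the case `k = 0`. Otherwise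
the regular representative may be integrated instead, and the fundamental theorem of calculus adds
one derivative. -/
theorem primitive {a b c : ℝ} (hc : c ∈ Set.Ioo a b) (hg : AERegularOn (Set.Ioo a b) k g)
    (hgi : LocallyIntegrable g) (d : ℂ) :
    AERegularOn (Set.Ioo a b) (k + 1) (fun x => (∫ t in c..x, g t) + d) := by
  refine ⟨_, ?_, Eventually.of_forall fun x _ => rfl⟩
  refine ContDiffOn.add ?_ contDiffOn_const
  cases k with
  | zero =>
    have hint : ∀ x y, IntervalIntegrable g volume x y := fun x y =>
      (hgi.integrableOn_isCompact isCompact_uIcc).intervalIntegrable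
    exact contDiffOn_zero.mpr (intervalIntegral.continuous_primitive hint c).continuousOn
  | succ k =>
    obtain ⟨v, hv, hgv⟩ := hg
    have hsub : ∀ x ∈ Set.Ioo a b, Set.uIcc c x ⊆ Set.Ioo a b := fun x hx =>
      Set.OrdConnected.uIcc_subset Set.ordConnected_Ioo hc hx
    have hd : ∀ x ∈ Set.Ioo a b, HasDerivAt (fun x => ∫ t in c..x, v t) (v x) x := fun x hx =>
      intervalIntegral.integral_hasDerivAt_right
        (hv.continuousOn.mono (hsub x hx)).intervalIntegrable
        (hv.continuousOn.stronglyMeasurableAtFilter isOpen_Ioo x hx)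
        (hv.continuousOn.continuousAt (isOpen_Ioo.mem_nhds hx))
    have hcd : ContDiffOn ℝ (k + 1 : ℕ) (fun x => ∫ t in c..x, v t) (Set.Ioo a b) := by
      push_cast
      rw [contDiffOn_succ_iff_deriv_of_isOpen isOpen_Ioo]
      refine ⟨fun x hx => (hd x hx).differentiableAt.differentiableWithinAt, by simp, ?_⟩
      exact hv.congr fun x hx => (hd x hx).deriv
    refine hcd.congr fun x hx => ?_
    refine intervalIntegral.integral_congr_ae ?_
    filter_upwards [hgv] with t ht htx
    exact ht (hsub x hx (Set.uIoc_subset_uIcc htx))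

end AERegularOn

/-- If `∑ m ≤ n + 1, (-1)^m (d/dx)^m (g m) = 0` weakly on an interval, then the leading function
`g (n + 1)` has one more degree of regularity than the others. -/
theorem AERegularOn.of_sum_integral_mul_iteratedDeriv_eq_zero {a b : ℝ} (hab : a < b) {k : ℕ}
    (n : ℕ) (g : ℕ → ℝ → ℂ) (hgi : ∀ m, LocallyIntegrable (g m))
    (hreg : ∀ m ≤ n, AERegularOn (Set.Ioo a b) k (g m))
    (hweak : ∀ φ, IsTestFunction (Set.Ioo a b) φ →
      ∑ m ∈ Finset.range (n + 2), ∫ x, g m x * iteratedDeriv m φ x = 0) :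
    AERegularOn (Set.Ioo a b) (k + 1) (g (n + 1)) := by
  have hc : (a + b) / 2 ∈ Set.Ioo a b := ⟨by linarith, by linarith⟩
  set c := (a + b) / 2
  -- Order reduction: writing the zeroth term as minus a primitive against `φ'` makes the whole
  -- relation a functional of `φ'`. A functional killing all derivatives is a constant `d` times the
  -- integral, so one differentiation can be stripped off.
  have step : ∀ (n : ℕ) (g : ℕ → ℝ → ℂ), (∀ m, LocallyIntegrable (g m)) →
      (∀ φ, IsTestFunction (Set.Ioo a b) φ →
        ∑ m ∈ Finset.range (n + 2), ∫ x, g m x * iteratedDeriv m φ x = 0) →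
      ∃ d : ℂ, ∀ φ, IsTestFunction (Set.Ioo a b) φ →
        (∑ m ∈ Finset.range n, ∫ x, g (m + 2) x * iteratedDeriv (m + 1) φ x) +
          ∫ x, (g 1 x - ((∫ t in c..x, g 0 t) + d)) * φ x = 0 := by
    intro n g hgi hweak
    have hint : ∀ x y, IntervalIntegrable (g 0) volume x y := fun x y =>
      ((hgi 0).integrableOn_isCompact isCompact_uIcc).intervalIntegrable
    have hJ : LocallyIntegrable fun x => ∫ t in c..x, g 0 t :=
      (intervalIntegral.continuous_primitive hint c).locallyIntegrable
    obtain ⟨d, hd⟩ : ∃ d : ℂ, ∀ φ, IsTestFunction (Set.Ioo a b) φ →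
        (∑ m ∈ Finset.range (n + 1), ∫ x, g (m + 1) x * iteratedDeriv m φ x) -
          ∫ x, (∫ t in c..x, g 0 t) * φ x = d * ∫ x, φ x := by
      refine exists_eq_const_mul_integral_of_annihilates_deriv hab
        (fun φ => (∑ m ∈ Finset.range (n + 1), ∫ x, g (m + 1) x * iteratedDeriv m φ x) -
          ∫ x, (∫ t in c..x, g 0 t) * φ x) ?_ ?_ ?_
      · intro φ ψ hφ hψ
        have h1 : ∀ m, (∫ x, g (m + 1) x * iteratedDeriv m (fun x => φ x - ψ x) x) =
            (∫ x, g (m + 1) x * iteratedDeriv m φ x) - ∫ x, g (m + 1) x * iteratedDeriv m ψ x := by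
          intro m
          rw [← integral_sub ((hφ.iteratedDeriv m).integrable_mul (hgi _))
            ((hψ.iteratedDeriv m).integrable_mul (hgi _))]
          refine integral_congr_ae (Eventually.of_forall fun x => ?_)
          have := iteratedDeriv_sub (x := x) (n := m)
            ((hφ.smooth.of_le (by exact_mod_cast le_top)).contDiffAt)
            ((hψ.smooth.of_le (by exact_mod_cast le_top)).contDiffAt)
          simp only [← mul_sub]
          exact congrArg _ this
        have h2 : (∫ x, (∫ t in c..x, g 0 t) * (φ x - ψ x)) =
            (∫ x, (∫ t in c..x, g 0 t) * φ x) - ∫ x, (∫ t in c..x, g 0 t) * ψ x := by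
          rw [← integral_sub (hφ.integrable_mul hJ) (hψ.integrable_mul hJ)]
          simp only [mul_sub]
        simp only [h1, h2, Finset.sum_sub_distrib]
        ring
      · intro s φ hφ
        have h1 : ∀ m, (∫ x, g (m + 1) x * iteratedDeriv m (fun x => s * φ x) x) =
            s * ∫ x, g (m + 1) x * iteratedDeriv m φ x := by
          intro m
          rw [← integral_const_mul]
          refine integral_congr_ae (Eventually.of_forall fun x => ?_)
          simp only [iteratedDeriv_const_mul_field]
          ring
        have h2 : (∫ x, (∫ t in c..x, g 0 t) * (s * φ x)) = s * ∫ x, (∫ t in c..x, g 0 t) * φ x := by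
          rw [← integral_const_mul]
          refine integral_congr_ae (Eventually.of_forall fun x => ?_)
          simp only
          ring
        simp only [h1, h2, ← Finset.mul_sum]
        ring
      · intro φ hφ
        have h1 := hweak φ hφ
        rw [Finset.sum_range_succ'] at h1
        simp only [iteratedDeriv_zero, integral_mul_testFunction_eq_neg_primitive (hgi 0) c hφ,
          iteratedDeriv_succ'] at h1
        rw [← h1]
        ring
    refine ⟨d, fun φ hφ => ?_⟩
    have h1 := hd φ hφ
    have hadd : Integrable fun x => (∫ t in c..x, g 0 t) * φ x + d * φ x :=
      (hφ.integrable_mul hJ).add (hφ.integrable.const_mul d)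
    simp only [sub_mul, add_mul]
    rw [integral_sub (hφ.integrable_mul (hgi 1)) hadd,
      integral_add (hφ.integrable_mul hJ) (hφ.integrable.const_mul d), integral_const_mul, ← h1,
      Finset.sum_range_succ']
    simp only [iteratedDeriv_zero]
    ring
  induction n generalizing g with
  | zero =>
    obtain ⟨d, hd⟩ := step 0 g hgi hweak
    have hp := AERegularOn.primitive hc (hreg 0 le_rfl) (hgi 0) d
    have hint : ∀ x y, IntervalIntegrable (g 0) volume x y := fun x y =>
      ((hgi 0).integrableOn_isCompact isCompact_uIcc).intervalIntegrable
    have hz := ae_eq_zero_of_integral_mul_testFunction isOpen_Ioo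
      (g := fun x => g 1 x - ((∫ t in c..x, g 0 t) + d))
      ((hgi 1).sub ((intervalIntegral.continuous_primitive hint c).add
        continuous_const).locallyIntegrable) (fun φ hφ => by simpa using hd φ hφ)
    refine hp.congr_ae ?_
    filter_upwards [hz] with x h1 hx
    exact sub_eq_zero.mp (h1 hx)
  | succ n ih =>
    obtain ⟨d, hd⟩ := step (n + 1) g hgi hweak
    have hint : ∀ x y, IntervalIntegrable (g 0) volume x y := fun x y =>
      ((hgi 0).integrableOn_isCompact isCompact_uIcc).intervalIntegrable
    -- The system of order one lower; the primitive of `g 0` and the constant are absorbed into its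
    -- zeroth entry, whose regularity is no worse than `k`.
    let g' : ℕ → ℝ → ℂ
      | 0 => fun x => g 1 x - ((∫ t in c..x, g 0 t) + d)
      | m + 1 => g (m + 2)
    refine ih g' ?_ ?_ ?_
    · rintro (_ | m)
      · exact (hgi 1).sub ((intervalIntegral.continuous_primitive hint c).add
          continuous_const).locallyIntegrable
      · exact hgi _
    · rintro (_ | m) hm
      · exact (hreg 1 (by omega)).sub (AERegularOn.primitive hc (hreg 0 (by omega)) (hgi 0) d).of_succ
      · exact hreg _ (by omega)
    · intro φ hφ
      rw [Finset.sum_range_succ', ← hd φ hφ]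
      simp only [g', iteratedDeriv_zero]

/-- Interior regularity for ordinary differential equations in transposed form. -/
theorem AERegularOn.of_weak_solution {a b : ℝ} (hab : a < b) (n : ℕ) {f : ℝ → ℂ}
    (hf : LocallyIntegrable f) {α : ℕ → ℝ → ℂ} (hα : ∀ m, ContDiff ℝ ∞ (α m))
    (hlead : ∀ x ∈ Set.Ioo a b, α (n + 1) x ≠ 0)
    (hweak : ∀ φ, IsTestFunction (Set.Ioo a b) φ →
      ∑ m ∈ Finset.range (n + 2), ∫ x, f x * α m x * iteratedDeriv m φ x = 0) (k : ℕ) :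
    AERegularOn (Set.Ioo a b) k f := by
  induction k with
  | zero => trivial
  | succ k ih =>
    have hgi : ∀ m, LocallyIntegrable fun x => f x * α m x := fun m =>
      hf.mul_continuous (hα m).continuous
    have h1 := AERegularOn.of_sum_integral_mul_iteratedDeriv_eq_zero hab n
      (fun m x => f x * α m x) hgi (fun m _ => ih.mul_contDiffOn (hα m).contDiffOn) hweak
    -- The product `f * α (n + 1)` has gained a degree; dividing by the smooth nonvanishing factor
    -- passes the gain to `f`.
    refine (h1.mul_contDiffOn ((hα (n + 1)).contDiffOn.inv hlead)).congr_ae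
      (Eventually.of_forall fun x hx => ?_)
    simp only [Pi.inv_apply]
    rw [mul_assoc, mul_inv_cancel₀ (hlead x hx), mul_one]

/-! ### The formal transpose and weak solutions. -/

namespace IsTestFunction

theorem finsetSum {ι : Type*} {I : Set ℝ} {F : ι → ℝ → ℂ} (s : Finset ι)
    (h : ∀ i ∈ s, IsTestFunction I (F i)) : IsTestFunction I (fun x => ∑ i ∈ s, F i x) := by
  classical
  induction s using Finset.induction_on with
  | empty =>
    have h0 : (fun _ : ℝ => (0 : ℂ)) = 0 := rfl
    simp only [Finset.sum_empty, h0]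
    exact ⟨contDiff_const, HasCompactSupport.zero, by simp [tsupport]⟩
  | insert i s hi ih =>
    have h1 := (h i (Finset.mem_insert_self i s)).sub
      ((ih fun j hj => h j (Finset.mem_insert_of_mem hj)).smooth_mul
        (contDiff_const (c := (-1 : ℂ))))
    convert h1 using 2
    rw [Finset.sum_insert hi]
    ring

end IsTestFunction

theorem ContDiff.iteratedDeriv_infty {q : ℝ → ℂ} (hq : ContDiff ℝ ∞ q) (m : ℕ) :
    ContDiff ℝ ∞ (iteratedDeriv m q) := by
  induction m with
  | zero => simpa using hq
  | succ m ih => rw [iteratedDeriv_succ]; exact (contDiff_infty_iff_deriv.mp ih).2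

namespace LinDiffOp

variable {M : ℕ}

/-- The formal transpose of a differential operator. -/
noncomputable def transpose (P : LinDiffOp M) (φ : ℝ → ℂ) (x : ℝ) : ℂ :=
  ∑ m : Fin (M + 1), (-1) ^ (m : ℕ) * iteratedDeriv (m : ℕ) (fun y => P.coeff m y * φ y) x

/-- The coefficients of the formal transpose. -/
noncomputable def transposeCoeff (P : LinDiffOp M) (j : ℕ) (x : ℝ) : ℂ :=
  ∑ m : Fin (M + 1), (-1) ^ (m : ℕ) * ((m : ℕ).choose j : ℂ) *
    iteratedDeriv ((m : ℕ) - j) (P.coeff m) x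

theorem isTestFunction_transpose (P : LinDiffOp M) {I : Set ℝ} {φ : ℝ → ℂ}
    (hφ : IsTestFunction I φ) : IsTestFunction I (P.transpose φ) :=
  IsTestFunction.finsetSum _ fun m _ =>
    ((hφ.smooth_mul (P.smooth m)).iteratedDeriv m).smooth_mul contDiff_const

theorem contDiff_transposeCoeff (P : LinDiffOp M) (j : ℕ) : ContDiff ℝ ∞ (P.transposeCoeff j) :=
  ContDiff.sum fun m _ => contDiff_const.mul ((P.smooth m).iteratedDeriv_infty _)

/-- Only the top-order term can put `M` derivatives on `φ`. Hence the transposed equation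
degenerates exactly where `P` does. -/
theorem transposeCoeff_last (P : LinDiffOp M) (x : ℝ) :
    P.transposeCoeff M x = (-1) ^ M * P.coeff (Fin.last M) x := by
  rw [transposeCoeff, Finset.sum_eq_single (Fin.last M)]
  · simp
  · intro m _ hm
    have : (m : ℕ) < M := Fin.val_lt_last hm
    simp [Nat.choose_eq_zero_of_lt this]
  · simp

theorem transpose_eq_sum (P : LinDiffOp M) {φ : ℝ → ℂ} (hφ : ContDiff ℝ ∞ φ) (x : ℝ) :
    P.transpose φ x =
      ∑ j ∈ Finset.range (M + 1), P.transposeCoeff j x * iteratedDeriv j φ x := by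
  have h1 : ∀ m : Fin (M + 1), iteratedDeriv (m : ℕ) (fun y => P.coeff m y * φ y) x =
      ∑ j ∈ Finset.range (M + 1), ((m : ℕ).choose j : ℂ) * iteratedDeriv j φ x *
        iteratedDeriv ((m : ℕ) - j) (P.coeff m) x := by
    intro m
    have h2 := iteratedDeriv_fun_mul (n := (m : ℕ)) (x := x) (f := φ) (g := P.coeff m)
      (hφ.of_le (by exact_mod_cast le_top)).contDiffAt
      ((P.smooth m).of_le (by exact_mod_cast le_top)).contDiffAt
    simp only [mul_comm (P.coeff m _)]
    rw [h2]
    refine Finset.sum_subset (Finset.range_subset_range.mpr (by omega)) fun j _ hj => ?_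
    rw [Nat.choose_eq_zero_of_lt (by simpa using hj)]
    simp
  simp only [transpose, transposeCoeff, h1, Finset.mul_sum, Finset.sum_mul]
  rw [Finset.sum_comm]
  refine Finset.sum_congr rfl fun j _ => Finset.sum_congr rfl fun m _ => ?_
  ring

theorem continuous_act (P : LinDiffOp M) {u : ℝ → ℂ} (hu : ContDiff ℝ M u) :
    Continuous (P.act u) := by
  refine continuous_finsetSum _ fun m _ => (P.smooth m).continuous.mul ?_
  exact hu.continuous_iteratedDeriv m (by exact_mod_cast Nat.lt_succ_iff.mp m.2)

theorem integral_act_mul (P : LinDiffOp M) {u : ℝ → ℂ} (hu : ContDiff ℝ M u) {I : Set ℝ}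
    {φ : ℝ → ℂ} (hφ : IsTestFunction I φ) :
    ∫ x, P.act u x * φ x = ∫ x, u x * P.transpose φ x := by
  have hm : ∀ m : Fin (M + 1), ((m : ℕ) : WithTop ℕ∞) ≤ (M : WithTop ℕ∞) := fun m => by
    exact_mod_cast Nat.lt_succ_iff.mp m.2
  simp only [act, transpose, Finset.sum_mul, Finset.mul_sum]
  rw [integral_finsetSum, integral_finsetSum]
  · refine Finset.sum_congr rfl fun m _ => ?_
    have h1 := integral_iteratedDeriv_mul_testFunction (m : ℕ) (hu.of_le (hm m))
      (hφ.smooth_mul (P.smooth m))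
    rw [← integral_const_mul] at h1
    refine (integral_congr_ae (Eventually.of_forall fun x => ?_)).trans (h1.trans
      (integral_congr_ae (Eventually.of_forall fun x => ?_)))
    · ring
    · simp only
      ring
  · intro m _
    exact (((hφ.smooth_mul (P.smooth m)).iteratedDeriv m).smooth_mul
      contDiff_const).integrable_mul hu.continuous.locallyIntegrable
  · intro m _
    have h1 := (hφ.smooth_mul (P.smooth m)).integrable_mul
      (hu.continuous_iteratedDeriv m (hm m)).locallyIntegrable
    refine h1.congr (Eventually.of_forall fun x => ?_)
    simp only
    ring

/-- A weak solution is, near a regular point, a classical solution. -/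
theorem exists_local_solution_of_weak (hM : 1 ≤ M) (P : LinDiffOp M) {f : ℝ → ℂ}
    (hf : LocallyIntegrable f)
    (hweak : ∀ φ, IsTestFunction P.singularSetᶜ φ → ∫ x, f x * P.transpose φ x = 0)
    {x : ℝ} (hx : x ∈ P.singularSetᶜ) :
    ∃ r > 0, ∃ v : ℝ → ℂ, ContDiff ℝ M v ∧ Metric.ball x r ⊆ P.singularSetᶜ ∧
      (∀ᵐ y, y ∈ Metric.ball x r → f y = v y) ∧ ∀ y ∈ Metric.ball x r, P.act v y = 0 := by
  have hopen : IsOpen P.singularSetᶜ :=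
    (isClosed_singleton.preimage (P.smooth (Fin.last M)).continuous).isOpen_compl
  obtain ⟨R, hR, hball⟩ := Metric.isOpen_iff.mp hopen x hx
  obtain ⟨n, rfl⟩ : ∃ n, M = n + 1 := ⟨M - 1, by omega⟩
  have hlead : ∀ y ∈ Set.Ioo (x - R) (x + R), P.transposeCoeff (n + 1) y ≠ 0 := by
    intro y hy
    rw [← Real.ball_eq_Ioo] at hy
    rw [transposeCoeff_last]
    exact mul_ne_zero (pow_ne_zero _ (by simp)) (hball hy)
  -- Because the index of `AERegularOn` is shifted by one, `n + 1 + 1` means class `C^M`.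
  have hreg := AERegularOn.of_weak_solution (a := x - R) (b := x + R) (by linarith) n hf
    (α := P.transposeCoeff) P.contDiff_transposeCoeff hlead (fun φ hφ => by
      rw [← Real.ball_eq_Ioo] at hφ
      rw [← hweak φ (hφ.mono hball), ← integral_finsetSum]
      · refine integral_congr_ae (Eventually.of_forall fun y => ?_)
        simp only [P.transpose_eq_sum hφ.smooth, Finset.mul_sum, mul_assoc]
      · intro j _
        exact (hφ.iteratedDeriv j).integrable_mul
          (hf.mul_continuous (P.contDiff_transposeCoeff j).continuous)) (n + 1 + 1)
  rw [← Real.ball_eq_Ioo] at hreg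
  obtain ⟨v0, hv0, hfv0⟩ := hreg
  -- Cutting off makes the local representative globally `C^M` without changing it near `x`, so that
  -- integration by parts on the line applies to it.
  let β : ContDiffBump x := ⟨R / 4, R / 2, by linarith, by linarith⟩
  have hβ1 : ∀ y ∈ Metric.ball x (R / 4), β y = 1 := fun y hy =>
    β.one_of_mem_closedBall (Metric.ball_subset_closedBall hy)
  have hsub : Metric.ball x (R / 4) ⊆ Metric.ball x R := Metric.ball_subset_ball (by linarith)
  have hv : ContDiff ℝ (n + 1 : ℕ) (fun y => (β y : ℂ) * v0 y) := by
    rw [contDiff_iff_contDiffAt]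
    intro y
    by_cases hy : y ∈ Metric.ball x R
    · refine ContDiffAt.mul ?_ (hv0.contDiffAt (Metric.isOpen_ball.mem_nhds hy))
      exact (Complex.ofRealCLM.contDiff.comp β.contDiff).contDiffAt
    · have hy' : y ∈ (Metric.closedBall x (R / 2))ᶜ := fun h =>
        hy (Metric.closedBall_subset_ball (by linarith) h)
      refine (contDiffAt_const (c := (0 : ℂ))).congr_of_eventuallyEq ?_
      filter_upwards [Metric.isClosed_closedBall.isOpen_compl.mem_nhds hy'] with z hz
      have : β z = 0 := β.zero_of_le_dist (by
        simp only [Set.mem_compl_iff, Metric.mem_closedBall, not_le] at hz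
        exact hz.le)
      simp [this]
  have hfv : ∀ᵐ y, y ∈ Metric.ball x (R / 4) → f y = (β y : ℂ) * v0 y := by
    filter_upwards [hfv0] with y h1 hy
    rw [h1 (hsub hy), hβ1 y hy]
    simp
  refine ⟨R / 4, by linarith, _, hv, hsub.trans hball, hfv, ?_⟩
  -- Transposing back, `P.act v` annihilates all test functions on the small ball; it vanishes
  -- almost everywhere there, hence everywhere by continuity.
  have hae := ae_eq_zero_of_integral_mul_testFunction (Metric.isOpen_ball (x := x) (ε := R / 4))
    (P.continuous_act hv).locallyIntegrable (fun φ hφ => by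
      rw [P.integral_act_mul hv hφ, ← hweak φ (hφ.mono (hsub.trans hball))]
      refine integral_congr_ae ?_
      filter_upwards [hfv] with y hy
      by_cases h : y ∈ Metric.ball x (R / 4)
      · rw [hy h]
      · have : P.transpose φ y = 0 := image_eq_zero_of_notMem_tsupport fun h' =>
          h ((P.isTestFunction_transpose hφ).support h')
        simp [this])
  exact Measure.eqOn_open_of_ae_eq (μ := volume)
    ((ae_restrict_iff' Metric.isOpen_ball.measurableSet).mpr hae) Metric.isOpen_ball
    (P.continuous_act hv).continuousOn continuousOn_const

/-- A weak solution is, off the singular set, a classical solution. -/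
theorem exists_solution_of_weak (hM : 1 ≤ M) (P : LinDiffOp M) {f : ℝ → ℂ}
    (hf : LocallyIntegrable f)
    (hweak : ∀ φ, IsTestFunction P.singularSetᶜ φ → ∫ x, f x * P.transpose φ x = 0) :
    ∃ u : ℝ → ℂ, f =ᵐ[volume] u ∧ ContDiffOn ℝ M u P.singularSetᶜ ∧
      ∀ x ∈ P.singularSetᶜ, P.act u x = 0 := by
  classical
  choose! r hr v hv hsub hfv hact using
    fun x (hx : x ∈ P.singularSetᶜ) => P.exists_local_solution_of_weak hM hf hweak hx
  have hcompat : ∀ x ∈ P.singularSetᶜ, ∀ y ∈ Metric.ball x (r x), v y y = v x y := by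
    intro x hx y hy
    have hyU := hsub x hx hy
    have hW : IsOpen (Metric.ball x (r x) ∩ Metric.ball y (r y)) :=
      Metric.isOpen_ball.inter Metric.isOpen_ball
    refine Measure.eqOn_open_of_ae_eq (μ := volume) ?_ hW (hv y hyU).continuous.continuousOn
      (hv x hx).continuous.continuousOn ⟨hy, Metric.mem_ball_self (hr y hyU)⟩
    refine (ae_restrict_iff' hW.measurableSet).mpr ?_
    filter_upwards [hfv x hx, hfv y hyU] with z h1 h2 hz
    rw [← h1 hz.1, ← h2 hz.2]
  -- The singular set may have positive measure, so `f` itself is kept there.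
  set u : ℝ → ℂ := fun x => if x ∈ P.singularSetᶜ then v x x else f x with hu
  have huv : ∀ x ∈ P.singularSetᶜ, ∀ y ∈ Metric.ball x (r x), u y = v x y := by
    intro x hx y hy
    rw [hu]
    simp only [if_pos (hsub x hx hy)]
    exact hcompat x hx y hy
  have hev : ∀ x ∈ P.singularSetᶜ, u =ᶠ[𝓝 x] v x := fun x hx => by
    filter_upwards [Metric.ball_mem_nhds x (hr x hx)] with y hy using huv x hx y hy
  refine ⟨u, ?_, fun x hx => ?_, fun x hx => ?_⟩
  · refine measure_null_of_locally_null _ fun x hx => ?_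
    have hxU : x ∈ P.singularSetᶜ := by
      by_contra h
      exact hx (if_neg h).symm
    refine ⟨{y | f y = u y}ᶜ ∩ Metric.ball x (r x), inter_mem_nhdsWithin _
      (Metric.ball_mem_nhds x (hr x hxU)), ?_⟩
    have h1 := hfv x hxU
    rw [ae_iff] at h1
    refine measure_mono_null ?_ h1
    rintro y ⟨hy1, hy2⟩ h
    exact hy1 ((h hy2).trans (huv x hxU y hy2).symm)
  · exact ((hv x hx).contDiffAt.congr_of_eventuallyEq (hev x hx)).contDiffWithinAt
  · rw [← hact x hx x (Metric.mem_ball_self (hr x hx))]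
    simp only [act]
    refine Finset.sum_congr rfl fun m _ => ?_
    rw [(hev x hx).iteratedDeriv_eq]

end LinDiffOp

/-! ### Weighted `L²` spaces and the inclusion. -/

open HilbertFunctionSpace in
/-- The inner product of `K` is the weighted `L²` inner product with weight `w`. -/
structure IsWeight (K : Type*) [NormedAddCommGroup K] [InnerProductSpace ℂ K]
    [HilbertFunctionSpace K] (w : ℝ → ℝ) : Prop where
  continuous : Continuous w
  pos : ∀ x, 0 < w x
  integrable : ∀ f g : K,
    Integrable (fun x : ℝ => (toAE f : ℝ → ℂ) x * star ((toAE g : ℝ → ℂ) x) * (w x : ℂ))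
  inner_eq : ∀ f g : K,
    inner ℂ g f = ∫ x : ℝ, (toAE f : ℝ → ℂ) x * star ((toAE g : ℝ → ℂ) x) * (w x : ℂ)

section

variable {H : Type*} [NormedAddCommGroup H] [InnerProductSpace ℂ H] [HilbertFunctionSpace H]
variable {K : Type*} [NormedAddCommGroup K] [InnerProductSpace ℂ K] [HilbertFunctionSpace K]

open HilbertFunctionSpace

theorem CondC2Plus.exists_isWeight {M : ℕ} (h : CondC2Plus M K) : ∃ w, IsWeight K w := by
  obtain ⟨w, h1, h2, h3⟩ := h
  exact ⟨w, h1.continuous, h2, fun f g => (h3 f g).1, fun f g => (h3 f g).2⟩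

theorem toAE_add_ae (f g : H) :
    (toAE (f + g) : ℝ → ℂ) =ᵐ[volume] fun x => (toAE f : ℝ → ℂ) x + (toAE g : ℝ → ℂ) x := by
  rw [map_add]; exact AEEqFun.coeFn_add _ _

theorem toAE_sub_ae (f g : H) :
    (toAE (f - g) : ℝ → ℂ) =ᵐ[volume] fun x => (toAE f : ℝ → ℂ) x - (toAE g : ℝ → ℂ) x := by
  rw [map_sub]; exact AEEqFun.coeFn_sub _ _

theorem toAE_smul_ae (c : ℂ) (f : H) :
    (toAE (c • f) : ℝ → ℂ) =ᵐ[volume] fun x => c * (toAE f : ℝ → ℂ) x := by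
  rw [map_smul]; exact AEEqFun.coeFn_smul _ _

namespace IsWeight

variable {w : ℝ → ℝ}

theorem integrable_normSq (hw : IsWeight K w) (g : K) : Integrable fun x => ‖(toAE g : ℝ → ℂ) x‖ ^ 2 * w x := by
  refine (hw.integrable g g).norm.congr (Eventually.of_forall fun x => ?_)
  simp only [norm_mul, norm_star, Complex.norm_real, Real.norm_eq_abs, abs_of_pos (hw.pos x)]
  ring

theorem norm_sq_eq (hw : IsWeight K w) (g : K) : ‖g‖ ^ 2 = ∫ x, ‖(toAE g : ℝ → ℂ) x‖ ^ 2 * w x := by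
  have h1 := hw.inner_eq g g
  rw [inner_self_eq_norm_sq_to_K] at h1
  have h2 : ∀ x, (toAE g : ℝ → ℂ) x * star ((toAE g : ℝ → ℂ) x) * (w x : ℂ) =
      ((‖(toAE g : ℝ → ℂ) x‖ ^ 2 * w x : ℝ) : ℂ) := fun x => by
    have := Complex.mul_conj' ((toAE g : ℝ → ℂ) x)
    simp only [Complex.star_def, this]
    push_cast
    ring
  simp only [h2, integral_complex_ofReal] at h1
  apply Complex.ofReal_injective
  rw [← h1]
  simp

/-- Completing the square. This pointwise bound replaces the Cauchy–Schwarz inequality: `t = 1`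
gives local integrability, `t = ‖ψ x‖` the boundedness of integration against `ψ`. -/
theorem norm_le (hw : IsWeight K w) (z : ℂ) (x : ℝ) (t : ℝ) :
    ‖z‖ * t ≤ (‖z‖ ^ 2 * w x + t ^ 2 * (w x)⁻¹) / 2 := by
  have h := hw.pos x
  have h1 : ‖z‖ ^ 2 * w x + t ^ 2 * (w x)⁻¹ - 2 * (‖z‖ * t) = (‖z‖ * w x - t) ^ 2 * (w x)⁻¹ := by
    field_simp
    ring
  have h2 : 0 ≤ (‖z‖ * w x - t) ^ 2 * (w x)⁻¹ := by positivity
  linarith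

theorem locallyIntegrable (hw : IsWeight K w) (g : K) : LocallyIntegrable (toAE g : ℝ → ℂ) := by
  rw [locallyIntegrable_iff]
  intro k hk
  have hinv : Continuous fun x => (w x)⁻¹ := hw.continuous.inv₀ fun x => (hw.pos x).ne'
  have h1 : IntegrableOn
      (fun x => (‖(toAE g : ℝ → ℂ) x‖ ^ 2 * w x + 1 ^ 2 * (w x)⁻¹) / 2) k :=
    (((hw.integrable_normSq g).integrableOn).add
      ((continuous_const.mul hinv).continuousOn.integrableOn_compact hk)).div_const 2
  refine h1.mono' (toAE g).aestronglyMeasurable.restrict (Eventually.of_forall fun x => ?_)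
  simpa using hw.norm_le ((toAE g : ℝ → ℂ) x) x 1

/-- Integration against a continuous function with compact support is a bounded functional. -/
theorem exists_integral_mul_eq_inner [CompleteSpace K] (hw : IsWeight K w) {ψ : ℝ → ℂ} (hψ : Continuous ψ)
    (hc : HasCompactSupport ψ) :
    ∃ k : K, ∀ g : K, ∫ x, (toAE g : ℝ → ℂ) x * ψ x = inner ℂ k g := by
  have hint : ∀ g : K, Integrable fun x => (toAE g : ℝ → ℂ) x * ψ x := fun g =>
    (hw.locallyIntegrable g).integrable_smul_right_of_hasCompactSupport hψ hc
  let T : K →ₗ[ℂ] ℂ :=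
    { toFun := fun g => ∫ x, (toAE g : ℝ → ℂ) x * ψ x
      map_add' := fun f g => by
        rw [← integral_add (hint f) (hint g)]
        refine integral_congr_ae ?_
        filter_upwards [toAE_add_ae f g] with x hx
        rw [hx, add_mul]
      map_smul' := fun c g => by
        rw [RingHom.id_apply, smul_eq_mul, ← integral_const_mul]
        refine integral_congr_ae ?_
        filter_upwards [toAE_smul_ae c g] with x hx
        rw [hx, mul_assoc] }
  have hinv : Continuous fun x => (w x)⁻¹ := hw.continuous.inv₀ fun x => (hw.pos x).ne'
  have hψi : Integrable fun x => ‖ψ x‖ ^ 2 * (w x)⁻¹ := by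
    have hcont : Continuous fun x => ‖ψ x‖ ^ 2 * (w x)⁻¹ := (hψ.norm.pow 2).mul hinv
    refine hcont.integrable_of_hasCompactSupport (hc.mono fun x hx h => hx ?_)
    simp only [h, norm_zero, ne_eq, OfNat.ofNat_ne_zero, not_false_eq_true, zero_pow, zero_mul]
  have hT : ∀ g, T g = ∫ x, (toAE g : ℝ → ℂ) x * ψ x := fun g => rfl
  have hbound : ∀ g ∈ Metric.ball (0 : K) 1,
      ‖T g‖ ≤ (1 + ∫ x, ‖ψ x‖ ^ 2 * (w x)⁻¹) / 2 := by
    intro g hg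
    have hg1 : ‖g‖ ^ 2 ≤ 1 := by
      rw [mem_ball_zero_iff] at hg
      exact pow_le_one₀ (norm_nonneg _) hg.le
    rw [hT]
    calc ‖∫ x, (toAE g : ℝ → ℂ) x * ψ x‖
          ≤ ∫ x, ‖(toAE g : ℝ → ℂ) x * ψ x‖ := norm_integral_le_integral_norm _
        _ ≤ ∫ x, (‖(toAE g : ℝ → ℂ) x‖ ^ 2 * w x + ‖ψ x‖ ^ 2 * (w x)⁻¹) / 2 := by
          refine integral_mono (hint g).norm
            (((hw.integrable_normSq g).add hψi).div_const 2) fun x => ?_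
          rw [norm_mul]
          exact hw.norm_le _ x _
        _ = (‖g‖ ^ 2 + ∫ x, ‖ψ x‖ ^ 2 * (w x)⁻¹) / 2 := by
          rw [integral_div, integral_add (hw.integrable_normSq g) hψi, ← hw.norm_sq_eq]
        _ ≤ _ := by linarith
  obtain ⟨C, hC⟩ := T.bound_of_ball_bound one_pos _ hbound
  refine ⟨(InnerProductSpace.toDual ℂ K).symm (T.mkContinuous C hC), fun g => ?_⟩
  rw [InnerProductSpace.toDual_symm_apply, ← hT]
  rfl

/-- Norm convergence implies almost everywhere convergence along a subsequence. -/
theorem exists_subseq_tendsto_ae (hw : IsWeight K w) {u : ℕ → K} {g : K} (hu : Tendsto u atTop (𝓝 g)) :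
    ∃ ns : ℕ → ℕ, StrictMono ns ∧ ∀ᵐ x : ℝ,
      Tendsto (fun k => (toAE (u (ns k)) : ℝ → ℂ) x) atTop (𝓝 ((toAE g : ℝ → ℂ) x)) := by
  -- These functions tend to zero in `L¹`, hence in measure, hence almost everywhere along a
  -- subsequence; positivity of `w` then allows dividing and taking roots.
  set F : ℕ → ℝ → ℝ := fun k x => ‖(toAE (u k - g) : ℝ → ℂ) x‖ ^ 2 * w x with hF
  have hFi : ∀ k, Integrable (F k) := fun k => hw.integrable_normSq _
  have h1 : TendstoInMeasure volume F atTop 0 := by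
    refine tendstoInMeasure_of_tendsto_eLpNorm one_ne_zero
      (fun k => (hFi k).aestronglyMeasurable) aestronglyMeasurable_const ?_
    have h2 : ∀ k, eLpNorm (F k - 0) 1 volume = ENNReal.ofReal (‖u k - g‖ ^ 2) := by
      intro k
      rw [sub_zero, eLpNorm_one_eq_lintegral_enorm, hw.norm_sq_eq,
        ← ofReal_integral_norm_eq_lintegral_enorm (hFi k)]
      congr 1
      refine integral_congr_ae (Eventually.of_forall fun x => ?_)
      exact Real.norm_of_nonneg (mul_nonneg (sq_nonneg _) (hw.pos x).le)
    simp only [h2]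
    rw [← ENNReal.ofReal_zero]
    refine ENNReal.tendsto_ofReal ?_
    have := (tendsto_iff_norm_sub_tendsto_zero.mp hu).pow 2
    simpa using this
  obtain ⟨ns, hns, hlim⟩ := h1.exists_seq_tendsto_ae
  refine ⟨ns, hns, ?_⟩
  have hsub : ∀ᵐ x : ℝ, ∀ k, (toAE (u k - g) : ℝ → ℂ) x =
      (toAE (u k) : ℝ → ℂ) x - (toAE g : ℝ → ℂ) x :=
    ae_all_iff.mpr fun k => toAE_sub_ae _ _
  filter_upwards [hlim, hsub] with x hx hs
  rw [tendsto_iff_norm_sub_tendsto_zero]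
  have h3 := (hx.mul_const (w x)⁻¹).sqrt
  simp only [Pi.zero_apply, zero_mul, Real.sqrt_zero] at h3
  refine h3.congr fun k => ?_
  rw [hF]
  simp only
  rw [mul_assoc, mul_inv_cancel₀ (hw.pos x).ne', mul_one, Real.sqrt_sq (norm_nonneg _), hs]

/-- An inclusion of function spaces is automatically continuous. -/
theorem exists_inclusion [CompleteSpace H] [CompleteSpace K] (hw : IsWeight K w) (hHK : FunctionSubset H K) :
    ∃ ι : H →L[ℂ] K, ∀ f, toAE (ι f) = toAE f := by
  choose j hj using hHK
  let J : H →ₗ[ℂ] K :=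
    { toFun := j
      map_add' := fun f g => toAE_injective (by simp only [hj, map_add])
      map_smul' := fun c f => toAE_injective (by simp only [hj, map_smul, RingHom.id_apply]) }
  -- Closed graph theorem: a subsequence converges almost everywhere to the limit in `K`, and the
  -- compatibility axiom of `H` identifies it with the limit in `H`.
  refine ⟨ContinuousLinearMap.ofSeqClosedGraph (g := J) fun u f g huf hug => ?_, hj⟩
  obtain ⟨ns, hns, hlim⟩ := hw.exists_subseq_tendsto_ae hug
  apply toAE_injective
  have h1 := ae_limit_eq (fun k => u (ns k)) f (toAE g) (huf.comp hns.tendsto_atTop) (by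
    filter_upwards [hlim] with x hx
    refine hx.congr fun k => ?_
    rw [Function.comp_apply]
    exact congrArg (fun q : ℝ →ₘ[volume] ℂ => (q : ℝ → ℂ) x) (hj _))
  rw [← h1]
  exact (hj f).symm

end IsWeight

end

/-! ### Closures of the operators and the first two implications. -/

theorem LinearPMap.isClosable_of_graph_closure {E F : Type*} [NormedAddCommGroup E]
    [NormedSpace ℂ E] [NormedAddCommGroup F] [NormedSpace ℂ F] (T : E →ₗ.[ℂ] F)
    (h : ∀ q ∈ T.graph.topologicalClosure, q.1 = 0 → q.2 = 0) : T.IsClosable :=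
  ⟨T.graph.topologicalClosure.toLinearPMap, (Submodule.toLinearPMap_graph_eq _ h).symm⟩

theorem LinearPMap.exists_apply_eq_iff_mem_graph {E F : Type*} [NormedAddCommGroup E]
    [NormedSpace ℂ E] [NormedAddCommGroup F] [NormedSpace ℂ F] (T : E →ₗ.[ℂ] F) (f : E) (g : F) :
    (∃ hf : f ∈ T.domain, T ⟨f, hf⟩ = g) ↔ (f, g) ∈ T.graph := by
  rw [LinearPMap.mem_graph_iff]
  constructor
  · rintro ⟨hf, h⟩
    exact ⟨⟨f, hf⟩, rfl, h⟩
  · rintro ⟨⟨y, hy⟩, h1, h2⟩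
    simp only at h1 h2
    subst h1
    exact ⟨hy, h2⟩

section

variable {M : ℕ}
variable {H : Type*} [NormedAddCommGroup H] [InnerProductSpace ℂ H] [HilbertFunctionSpace H]
variable {K : Type*} [NormedAddCommGroup K] [InnerProductSpace ℂ K] [HilbertFunctionSpace K]

open HilbertFunctionSpace

theorem integral_mul_eq_of_mem_actionGraph (P : LinDiffOp M) {q : H × K}
    (hq : q ∈ actionGraph P H K) {I : Set ℝ} {φ : ℝ → ℂ} (hφ : IsTestFunction I φ) :
    ∫ x, (toAE q.2 : ℝ → ℂ) x * φ x = ∫ x, (toAE q.1 : ℝ → ℂ) x * P.transpose φ x := by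
  obtain ⟨u, ⟨hu, h1⟩, h2⟩ := hq
  have h3 : ∫ x, (toAE q.2 : ℝ → ℂ) x * φ x = ∫ x, P.act u x * φ x := by
    refine integral_congr_ae ?_
    filter_upwards [h2] with x hx
    rw [hx]
  rw [h3, P.integral_act_mul hu hφ]
  refine integral_congr_ae ?_
  filter_upwards [h1] with x hx
  rw [hx]

theorem mem_opBTilde_domain_iff (P : LinDiffOp M) (lam : ℂ) (f : H) :
    f ∈ (opBTilde P lam H K).domain ↔ ∃ g : K, (f, g) ∈ actionGraph (P.shift lam) H K := by
  have hg : (opBTilde P lam H K).graph = actionGraph (P.shift lam) H K := actionOp_graph _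
  rw [LinearPMap.mem_domain_iff, hg]

theorem mem_actionGraph_opB (P : LinDiffOp M) (lam : ℂ) {f : H}
    (hf : f ∈ (opBTilde P lam H K).domain) :
    (f, opB P lam H K ⟨f, mem_opB_of_mem_opBTilde P lam hf⟩) ∈
      actionGraph (P.shift lam) H K := by
  have hg : (opBTilde P lam H K).graph = actionGraph (P.shift lam) H K := actionOp_graph _
  have h1 : opBTilde P lam H K ⟨f, hf⟩ =
      opB P lam H K ⟨f, mem_opB_of_mem_opBTilde P lam hf⟩ :=
    (opBTilde P lam H K).le_closure.2 rfl
  rw [← h1, ← hg]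
  exact LinearPMap.mem_graph _ ⟨f, hf⟩

variable [CompleteSpace K] {w : ℝ → ℝ} {ι : H →L[ℂ] K}

/-- Both sides are inner products with fixed vectors of `K`, the right one after the continuous
inclusion, so the identity defines a closed set containing the action graph. -/
theorem integral_mul_eq_of_mem_closure_actionGraph (hw : IsWeight K w)
    (hι : ∀ f, toAE (ι f) = toAE f) (P : LinDiffOp M) {q : H × K}
    (hq : q ∈ (actionGraph P H K).topologicalClosure) {I : Set ℝ} {φ : ℝ → ℂ}
    (hφ : IsTestFunction I φ) :
    ∫ x, (toAE q.2 : ℝ → ℂ) x * φ x = ∫ x, (toAE q.1 : ℝ → ℂ) x * P.transpose φ x := by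
  obtain ⟨k, hk⟩ := hw.exists_integral_mul_eq_inner hφ.continuous hφ.compact
  obtain ⟨l, hl⟩ := hw.exists_integral_mul_eq_inner (P.isTestFunction_transpose hφ).continuous
    (P.isTestFunction_transpose hφ).compact
  have hl' : ∀ f : H, ∫ x, (toAE f : ℝ → ℂ) x * P.transpose φ x = inner ℂ l (ι f) := fun f => by
    rw [← hl, hι]
  rw [hk, hl']
  have hclosed : IsClosed {q : H × K | (inner ℂ k q.2 : ℂ) = inner ℂ l (ι q.1)} :=
    isClosed_eq (continuous_const.inner continuous_snd)
      (continuous_const.inner (ι.continuous.comp continuous_fst))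
  refine closure_minimal (fun q hq => ?_) hclosed hq
  rw [Set.mem_ofPred_eq, ← hk, ← hl']
  exact integral_mul_eq_of_mem_actionGraph P hq hφ

/-- With first component zero, the weak identity makes the second component annihilate every test
function. -/
theorem closure_actionGraph_functional (hw : IsWeight K w)
    (hι : ∀ f, toAE (ι f) = toAE f) (P : LinDiffOp M) :
    ∀ q ∈ (actionGraph P H K).topologicalClosure, q.1 = 0 → q.2 = 0 := by
  intro q hq h0
  apply toAE_injective
  rw [map_zero]
  refine AEEqFun.ext (Filter.EventuallyEq.trans ?_ AEEqFun.coeFn_zero.symm)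
  have h1 := ae_eq_zero_of_integral_mul_testFunction isOpen_univ (hw.locallyIntegrable q.2)
    (fun φ hφ => by
      rw [integral_mul_eq_of_mem_closure_actionGraph hw hι P hq hφ, h0, map_zero]
      refine integral_eq_zero_of_ae ?_
      filter_upwards [AEEqFun.coeFn_zero (α := ℝ) (β := ℂ) (μ := volume)] with x hx
      rw [hx]
      simp)
  filter_upwards [h1] with x hx
  simpa using hx trivial

/-- `LinearPMap.closure` leaves a non-closable operator unchanged, so closability must be supplied
before the graph can be identified. -/
theorem opB_graph_eq (hw : IsWeight K w) (hι : ∀ f, toAE (ι f) = toAE f) (P : LinDiffOp M)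
    (lam : ℂ) :
    (opB P lam H K).graph = (actionGraph (P.shift lam) H K).topologicalClosure := by
  have hg : (opBTilde P lam H K).graph = actionGraph (P.shift lam) H K := actionOp_graph _
  have hc : (opBTilde P lam H K).IsClosable := LinearPMap.isClosable_of_graph_closure _ (by
    rw [hg]; exact closure_actionGraph_functional hw hι _)
  rw [opB, ← hc.graph_closure_eq_closure_graph, hg]

/-- The weight belongs to `K`, not to `H`. Applying the injective continuous inclusion to the second
component reduces closability in `H` to that of the action from `H` to `K`. -/
theorem opA_graph_eq (hw : IsWeight K w) (hι : ∀ f, toAE (ι f) = toAE f) (P : LinDiffOp M) :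
    (opA P H).graph = (actionGraph P H H).topologicalClosure := by
  have hg : (opATilde P H).graph = actionGraph P H H := actionOp_graph _
  have hc : (opATilde P H).IsClosable := LinearPMap.isClosable_of_graph_closure _ (by
    rw [hg]
    intro q hq h0
    have h1 : ((q.1, ι q.2) : H × K) ∈ (actionGraph P H K).topologicalClosure := by
      have hcont : Continuous fun q : H × H => (q.1, ι q.2) := by fun_prop
      refine map_mem_closure (f := fun q : H × H => (q.1, ι q.2)) hcont hq fun q hq => ?_
      obtain ⟨u, hu, h2⟩ := hq
      exact ⟨u, hu, by simpa only [hι] using h2⟩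
    have h2 : ι q.2 = 0 := closure_actionGraph_functional hw hι P _ h1 h0
    apply toAE_injective
    rw [← hι, h2, map_zero, map_zero])
  rw [opA, ← hc.graph_closure_eq_closure_graph, hg]

theorem mem_opB_graph_of_mem_opA_graph (hw : IsWeight K w) (hι : ∀ f, toAE (ι f) = toAE f)
    (P : LinDiffOp M) (lam : ℂ) {q : H × H} (hq : q ∈ (opA P H).graph) :
    (q.1, ι (q.2 - lam • q.1)) ∈ (opB P lam H K).graph := by
  rw [opA_graph_eq hw hι] at hq
  rw [opB_graph_eq hw hι]
  have hcont : Continuous fun q : H × H => (q.1, ι (q.2 - lam • q.1)) := by fun_prop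
  refine map_mem_closure (f := fun q : H × H => (q.1, ι (q.2 - lam • q.1))) hcont hq
    fun q hq => ?_
  obtain ⟨u, hu, h2⟩ := hq
  refine ⟨u, hu, ?_⟩
  simp only [hι]
  filter_upwards [toAE_sub_ae q.2 (lam • q.1), toAE_smul_ae lam q.1, h2, hu.2] with x h3 h4 h5 h6
  rw [h3, h4, h5, h6, LinDiffOp.act_shift]

/-- The matrix of `B` is the matrix of the adjoint relation C3, so that the coefficients of a
function in the kernel of `B` solve the linear system. -/
theorem mem_solutionSpace_of_mem_opB_graph (hw : IsWeight K w)
    (hι : ∀ f, toAE (ι f) = toAE f) (P : LinDiffOp M) (lam : ℂ) (e : HilbertBasis ℕ ℂ H)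
    (e' : HilbertBasis ℕ ℂ K) (hC1 : CondC1 P lam e K) (hC3 : CondC3 P lam H e') {f : H}
    (hf : (f, (0 : K)) ∈ (opB P lam H K).graph) :
    (fun n => inner ℂ (e n) f) ∈ solutionSpace (matrixElem P lam e e' hC1) := by
  obtain ⟨C, -, hC⟩ := hC3
  intro m
  obtain ⟨hm, hCm⟩ := hC m
  have h1 : ∀ n, matrixElem P lam e e' hC1 m n = inner ℂ (C ⟨e' m, hm⟩) (e n) := fun n =>
    hCm (e n) (hC1 n)
  simp only [h1]
  have h2 : inner ℂ (C ⟨e' m, hm⟩) f = (0 : ℂ) := by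
    rw [opB_graph_eq hw hι] at hf
    -- C3 holds on the domain of `B̃`; both sides are continuous on `H × K`, so it extends to the
    -- graph of `B`.
    have hclosed : IsClosed
        {q : H × K | (inner ℂ (C ⟨e' m, hm⟩) q.1 : ℂ) = inner ℂ (e' m) q.2} :=
      isClosed_eq (continuous_const.inner continuous_fst) (continuous_const.inner continuous_snd)
    have h3 : (inner ℂ (C ⟨e' m, hm⟩) f : ℂ) = inner ℂ (e' m) (0 : K) := by
      refine closure_minimal (fun q hq => ?_) hclosed hf
      have hdom : q.1 ∈ (opBTilde P lam H K).domain :=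
        (mem_opBTilde_domain_iff P lam q.1).mpr ⟨q.2, hq⟩
      have h4 := actionGraph_functional (P.shift lam) _
        ((actionGraph (P.shift lam) H K).sub_mem (mem_actionGraph_opB P lam hdom) hq) (by simp)
      rw [Set.mem_ofPred_eq, ← hCm q.1 hdom]
      exact congrArg _ (sub_eq_zero.mp h4)
    rw [h3, inner_zero_right]
  rw [← h2]
  exact e.hasSum_inner_mul_inner _ _

end

/-! ### Coefficient decay and truncation errors. -/

/-- Transposing a first-order operator `j` times onto a test function. -/
theorem exists_transposed_testFunction {n1 n0 : ℝ → ℂ} {k : ℕ} (hn1 : ContDiff ℝ k n1)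
    (hn0 : ContDiff ℝ k n0) {j : ℕ} (hjk : j ≤ k) {φ : ℝ → ℂ} (hφ : ContDiff ℝ j φ)
    (hc : HasCompactSupport φ) :
    ∃ ψ : ℝ → ℂ, Continuous ψ ∧ HasCompactSupport ψ ∧ ∀ (u : ℝ → ℂ) (μ : ℂ), ContDiff ℝ 1 u →
      (∀ x, n1 x * deriv u x + n0 x * u x = μ * u x) →
      μ ^ j * ∫ x, u x * φ x = ∫ x, u x * ψ x := by
  induction j generalizing φ with
  | zero => exact ⟨φ, hφ.continuous, hc, fun u μ _ _ => by simp⟩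
  | succ j ih =>
    have h1 : ContDiff ℝ (j + 1) (fun x => n1 x * φ x) :=
      (hn1.of_le (by exact_mod_cast hjk)).mul hφ
    have hc1 : HasCompactSupport fun x => n1 x * φ x := hc.mul_left
    have h1' : ContDiff ℝ j (deriv fun x => n1 x * φ x) :=
      (contDiff_succ_iff_deriv.mp h1).2.2
    have h2 : ContDiff ℝ j (fun x => n0 x * φ x) :=
      (hn0.of_le (by exact_mod_cast (Nat.le_succ j).trans hjk)).mul
        (hφ.of_le (by exact_mod_cast Nat.le_succ j))
    have hc2 : HasCompactSupport fun x => n0 x * φ x := hc.mul_left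
    -- One transposition replaces `φ` by `n0 φ - (n1 φ)'` and costs one derivative.
    obtain ⟨ψ, hψ, hψc, h⟩ := ih ((Nat.le_succ j).trans hjk) (h2.sub h1') (hc2.sub hc1.deriv)
    refine ⟨ψ, hψ, hψc, fun u μ hu hev => ?_⟩
    rw [← h u μ hu hev, pow_succ, mul_assoc]
    congr 1
    have h3 := integral_deriv_mul_of_hasCompactSupport hu
      (h1.of_le (by exact_mod_cast Nat.le_add_left 1 j)) hc1
    have hu' : Continuous (deriv u) := hu.continuous_deriv le_rfl
    have hi1 : Integrable fun x => deriv u x * (n1 x * φ x) :=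
      (hu'.mul h1.continuous).integrable_of_hasCompactSupport hc1.mul_left
    have hi2 : Integrable fun x => u x * (n0 x * φ x) :=
      (hu.continuous.mul h2.continuous).integrable_of_hasCompactSupport hc2.mul_left
    have hi3 : Integrable fun x => u x * deriv (fun x => n1 x * φ x) x :=
      (hu.continuous.mul h1'.continuous).integrable_of_hasCompactSupport hc1.deriv.mul_left
    calc μ * ∫ x, u x * φ x = ∫ x, (deriv u x * (n1 x * φ x) + u x * (n0 x * φ x)) := by
          rw [← integral_const_mul]
          refine integral_congr_ae (Eventually.of_forall fun x => ?_)
          simp only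
          rw [← mul_assoc, ← hev x]
          ring
      _ = ∫ x, (u x * (n0 x * φ x) - u x * deriv (fun x => n1 x * φ x) x) := by
          rw [integral_add hi1 hi2, integral_sub hi2 hi3, h3]
          ring
      _ = _ := by
          refine integral_congr_ae (Eventually.of_forall fun x => ?_)
          simp only
          ring

theorem summable_sum_mul_shift {α s : ℕ → ℂ} (hα : Summable fun n => ‖α n‖ ^ 2)
    (hs : Summable fun n => ‖s n‖ ^ 2) (R : ℕ) :
    Summable fun N => ∑ i ∈ Finset.range R, ∑ j ∈ Finset.range R, ‖α (N + i)‖ * ‖s (N + j)‖ := by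
  refine summable_sum fun i _ => summable_sum fun j _ => ?_
  refine Summable.of_nonneg_of_le (fun N => by positivity) (fun N => ?_)
    (((summable_nat_add_iff i).mpr hα).add ((summable_nat_add_iff j).mpr hs))
  nlinarith [sq_nonneg (‖α (N + i)‖ - ‖s (N + j)‖), sq_nonneg (‖α (N + i)‖), sq_nonneg ‖s (N + j)‖]

/-- A nonzero limit would force `D * S N` to be eventually at least a positive multiple of `1 / N`,
contradicting divergence of the harmonic series. -/
theorem eq_zero_of_tendsto_of_norm_le_mul_summable {J : ℕ → ℂ} {L : ℂ} {S : ℕ → ℝ} {D : ℝ}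
    (hJ : Tendsto J atTop (𝓝 L)) (hS : Summable S) (hle : ∀ᶠ N in atTop, ‖J N‖ ≤ D * N * S N) :
    L = 0 := by
  by_contra hL
  have hL' : 0 < ‖L‖ := norm_pos_iff.mpr hL
  have h1 : ∀ᶠ N in atTop, ‖L‖ / 2 < ‖J N‖ := hJ.norm.eventually_const_lt (by linarith)
  apply Real.not_summable_one_div_natCast
  refine Summable.of_norm_bounded_eventually_nat (g := fun N => 2 / ‖L‖ * (D * S N))
    ((hS.mul_left D).mul_left _) ?_
  filter_upwards [h1, hle, eventually_gt_atTop 0] with N h2 h3 hN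
  have hN' : (0 : ℝ) < N := by exact_mod_cast hN
  rw [Real.norm_of_nonneg (by positivity), div_le_iff₀ hN']
  have h4 : ‖L‖ / 2 ≤ D * N * S N := h2.le.trans h3
  have h5 : 2 / ‖L‖ * (‖L‖ / 2) ≤ 2 / ‖L‖ * (D * N * S N) :=
    mul_le_mul_of_nonneg_left h4 (by positivity)
  have h6 : 2 / ‖L‖ * (‖L‖ / 2) = 1 := by field_simp
  calc 1 ≤ 2 / ‖L‖ * (D * N * S N) := h6 ▸ h5
    _ = _ := by ring

/-- The truncation errors of a square-summable solution of a band system, tested against a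
functional whose coefficients gain `p` powers beyond square summability, cannot have a nonzero
limit when the matrix grows at most like `n ^ (p + 1)`. -/
theorem eq_zero_of_tendsto_truncation {b : ℕ → ℕ → ℂ} {s α β : ℕ → ℂ} {ℓ p m0 : ℕ} {c d : ℝ}
    (hc : 0 ≤ c) (hband : ∀ m n, m + ℓ < n ∨ n + ℓ < m → b m n = 0)
    (hb : ∀ m n, 1 ≤ n → ‖b m n‖ ≤ c * (n : ℝ) ^ (p + 1))
    (hs : Summable fun n => ‖s n‖ ^ 2) (hsol : ∀ m, HasSum (fun n => b m n * s n) 0)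
    (hα : Summable fun n => ‖α n‖ ^ 2) (hβ : ∀ m, m0 ≤ m → ‖β m‖ * (m : ℝ) ^ p ≤ d * ‖α m‖)
    {J : ℕ → ℂ} {L : ℂ}
    (hJ : ∀ N, HasSum (fun m => β m * ∑ n ∈ Finset.range N, b m n * s n) (J N))
    (hL : Tendsto J atTop (𝓝 L)) : L = 0 := by
  -- For these rows the truncation already contains every nonzero entry, so the sum is the full row
  -- equation.
  have hlow : ∀ N m, m + ℓ < N → ∑ n ∈ Finset.range N, b m n * s n = 0 := by
    intro N m hm
    refine (hasSum_sum_of_ne_finset_zero fun n hn => ?_).unique (hsol m)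
    rw [Finset.mem_range, not_lt] at hn
    rw [hband m n (Or.inl (by omega)), zero_mul]
  have hhigh : ∀ N m, N + ℓ ≤ m → ∑ n ∈ Finset.range N, b m n * s n = 0 := by
    intro N m hm
    refine Finset.sum_eq_zero fun n hn => ?_
    rw [Finset.mem_range] at hn
    rw [hband m n (Or.inr (by omega)), zero_mul]
  set R := 3 * ℓ + 1 with hR
  -- Truncating at `N + 2 * ℓ` avoids subtraction: the surviving rows start at `N + ℓ`, and their
  -- nonzero columns start no earlier than `N`.
  have hJeq : ∀ N, J (N + 2 * ℓ) = ∑ i ∈ Finset.range R, ∑ j ∈ Finset.range R,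
      if ℓ ≤ i ∧ j < 2 * ℓ then β (N + i) * (b (N + i) (N + j) * s (N + j)) else 0 := by
    intro N
    have h1 : HasSum (fun m => β m * ∑ n ∈ Finset.range (N + 2 * ℓ), b m n * s n)
        (∑ m ∈ Finset.Ico (N + ℓ) (N + R),
          β m * ∑ n ∈ Finset.range (N + 2 * ℓ), b m n * s n) := by
      refine hasSum_sum_of_ne_finset_zero fun m hm => ?_
      rw [Finset.mem_Ico, not_and_or, not_le, not_lt] at hm
      rcases hm with hm | hm
      · rw [hlow _ _ (by omega), mul_zero]
      · rw [hhigh _ _ (by omega), mul_zero]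
    rw [(hJ _).unique h1]
    have h2 : Finset.Ico (N + ℓ) (N + R) =
        ((Finset.range R).filter (ℓ ≤ ·)).map (addLeftEmbedding N) := by
      ext m
      simp only [Finset.mem_Ico, Finset.mem_map, Finset.mem_filter, Finset.mem_range,
        addLeftEmbedding_apply]
      constructor
      · intro h
        exact ⟨m - N, ⟨by omega, by omega⟩, by omega⟩
      · rintro ⟨i, hi, rfl⟩
        omega
    rw [h2, Finset.sum_map, Finset.sum_filter]
    refine Finset.sum_congr rfl fun i hi => ?_
    by_cases hi' : ℓ ≤ i
    · simp only [hi', if_true, true_and, addLeftEmbedding_apply]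
      rw [← Finset.sum_filter, ← Finset.mul_sum]
      congr 1
      rw [← Finset.sum_range_add_sum_Ico _ (Nat.le_add_right N (2 * ℓ))]
      rw [Finset.sum_eq_zero, zero_add]
      · rw [Finset.sum_Ico_eq_sum_range]
        refine Finset.sum_congr ?_ fun _ _ => rfl
        ext j
        simp only [Finset.mem_range, Finset.mem_filter]
        omega
      · intro n hn
        rw [Finset.mem_range] at hn
        rw [hband _ _ (Or.inr (by omega)), zero_mul]
    · simp [hi']
  have hlim : Tendsto (fun N => J (N + 2 * ℓ)) atTop (𝓝 L) := (tendsto_add_atTop_iff_nat _).mpr hL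
  refine eq_zero_of_tendsto_of_norm_le_mul_summable (D := c * d * 2 ^ (p + 1)) hlim
    (summable_sum_mul_shift hα hs R) ?_
  filter_upwards [eventually_ge_atTop (m0 + R)] with N hN
  have hNpos : (0 : ℝ) < N := by exact_mod_cast (by omega : 0 < N)
  rw [hJeq, Finset.mul_sum]
  refine (norm_sum_le _ _).trans (Finset.sum_le_sum fun i hi => ?_)
  rw [Finset.mul_sum]
  refine (norm_sum_le _ _).trans (Finset.sum_le_sum fun j hj => ?_)
  rw [Finset.mem_range] at hi hj
  have hd : 0 ≤ d * ‖α (N + i)‖ := le_trans (by positivity) (hβ (N + i) (by omega))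
  -- Rows and columns in the window are comparable with `N`. The factor `(N + i) ^ p` will be
  -- absorbed by the decay of `β`; one power of `N` remains.
  have hpow : ((N + j : ℕ) : ℝ) ^ (p + 1) ≤ 2 ^ (p + 1) * N * ((N + i : ℕ) : ℝ) ^ p := by
    have h1 : ((N + j : ℕ) : ℝ) ≤ 2 * N := by exact_mod_cast (by omega : N + j ≤ 2 * N)
    have h2 : (N : ℝ) ≤ ((N + i : ℕ) : ℝ) := by exact_mod_cast Nat.le_add_right N i
    calc ((N + j : ℕ) : ℝ) ^ (p + 1) ≤ (2 * N : ℝ) ^ (p + 1) := by gcongr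
      _ = 2 ^ (p + 1) * N * (N : ℝ) ^ p := by ring
      _ ≤ _ := by gcongr
  have hterm : ‖β (N + i) * (b (N + i) (N + j) * s (N + j))‖ ≤
      c * d * 2 ^ (p + 1) * N * (‖α (N + i)‖ * ‖s (N + j)‖) := by
    rw [norm_mul, norm_mul]
    calc ‖β (N + i)‖ * (‖b (N + i) (N + j)‖ * ‖s (N + j)‖)
        ≤ ‖β (N + i)‖ * ((c * (2 ^ (p + 1) * N * ((N + i : ℕ) : ℝ) ^ p)) * ‖s (N + j)‖) := by
          gcongr
          exact (hb _ _ (by omega)).trans (mul_le_mul_of_nonneg_left hpow hc)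
      _ = c * 2 ^ (p + 1) * N * ‖s (N + j)‖ * (‖β (N + i)‖ * ((N + i : ℕ) : ℝ) ^ p) := by ring
      _ ≤ c * 2 ^ (p + 1) * N * ‖s (N + j)‖ * (d * ‖α (N + i)‖) :=
          mul_le_mul_of_nonneg_left (hβ _ (by omega)) (by positivity)
      _ = _ := by ring
  split_ifs
  · exact hterm
  · exact norm_zero.trans_le ((norm_nonneg _).trans hterm)

/-! ### From the linear system to a weak solution. -/

section

variable {M : ℕ}
variable {H : Type*} [NormedAddCommGroup H] [InnerProductSpace ℂ H] [HilbertFunctionSpace H]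
variable {K : Type*} [NormedAddCommGroup K] [InnerProductSpace ℂ K] [HilbertFunctionSpace K]

open HilbertFunctionSpace

theorem CondC2.exists_nat {b : ℕ → ℕ → ℂ} (h : CondC2 b) :
    ∃ ℓ : ℕ, ∀ m n, m + ℓ < n ∨ n + ℓ < m → b m n = 0 := by
  obtain ⟨l0, h⟩ := h
  refine ⟨l0.toNat, fun m n hmn => h m n ((Int.self_le_toNat l0).trans_lt ?_)⟩
  rw [lt_abs]
  omega

theorem CondC21.exists_bound {b : ℕ → ℕ → ℂ} (h : CondC21 M b) :
    ∃ c : ℝ, 0 ≤ c ∧ ∀ m n : ℕ, 1 ≤ n → ‖b m n‖ ≤ c * (n : ℝ) ^ M := by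
  obtain ⟨c, h⟩ := h
  have hc := h 0 1 le_rfl
  refine ⟨c, le_trans (by positivity) hc, fun m n hn => ?_⟩
  have hn' : (0 : ℝ) < n := by exact_mod_cast hn
  exact (div_le_iff₀ (by positivity)).mp (h m n hn)

/-- The coefficients of a test function with respect to the `e'` decay: after multiplication by
`m ^ (M - 1)` they are still square summable. -/
theorem CondC22.exists_coefficient_bound [CompleteSpace K] {w : ℝ → ℝ} (hw : IsWeight K w)
    {p : ℕ} {e' : HilbertBasis ℕ ℂ K} (h : CondC22 (p + 1) e') {I : Set ℝ} {φ : ℝ → ℂ}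
    (hφ : IsTestFunction I φ) :
    ∃ (α : ℕ → ℂ) (d : ℝ) (m0 : ℕ), (Summable fun m => ‖α m‖ ^ 2) ∧
      ∀ m, m0 ≤ m → ‖∫ x, (toAE (e' m) : ℝ → ℂ) x * φ x‖ * (m : ℝ) ^ p ≤ d * ‖α m‖ := by
  obtain ⟨n1, n0, ev, hn1, hn0, hu, hlim⟩ := h
  rw [Nat.add_sub_cancel] at hn1 hn0
  -- The coefficients `n1`, `n0` are of class `C^p`, which permits `p` transpositions. The `m`-th
  -- coefficient of `ψ` is then `ev m ^ p` times that of `φ`.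
  obtain ⟨ψ, hψ, hψc, htr⟩ := exists_transposed_testFunction hn1 hn0 le_rfl
    (hφ.smooth.of_le (by exact_mod_cast le_top)) hφ.compact
  obtain ⟨k, hk⟩ := hw.exists_integral_mul_eq_inner hψ hψc
  obtain ⟨c, hc0, hc⟩ := EReal.lt_iff_exists_real_btwn.mp hlim
  have hc0' : 0 < c := by exact_mod_cast hc0
  obtain ⟨m0, hm0⟩ := eventually_atTop.mp (eventually_lt_of_lt_liminf hc)
  refine ⟨fun m => inner ℂ k (e' m), (c ^ p)⁻¹, m0 + 1, ?_, fun m hm => ?_⟩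
  · refine (e'.orthonormal.inner_products_summable k).congr fun m => ?_
    rw [norm_inner_symm]
  · obtain ⟨u, ⟨huC, hue⟩, hev⟩ := hu m
    have hint : ∀ χ : ℝ → ℂ, ∫ x, (toAE (e' m) : ℝ → ℂ) x * χ x = ∫ x, u x * χ x := fun χ => by
      refine integral_congr_ae ?_
      filter_upwards [hue] with x hx
      rw [hx]
    have h1 := htr u (ev m) (huC.of_le (by exact_mod_cast Nat.le_add_left 1 p)) hev
    rw [← hint, ← hint, hk] at h1
    beta_reduce
    rw [← h1, norm_mul, norm_pow, Complex.norm_real, Real.norm_eq_abs, mul_comm,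
      ← mul_assoc]
    refine mul_le_mul_of_nonneg_right ?_ (norm_nonneg _)
    have hmpos : (0 : ℝ) < m := by exact_mod_cast (by omega : 0 < m)
    have h2 : c < |ev m| / m := by exact_mod_cast hm0 m (by omega)
    have h3 : c * m ≤ |ev m| := ((lt_div_iff₀ hmpos).mp h2).le
    rw [inv_mul_eq_div, le_div_iff₀ (by positivity), ← mul_pow, mul_comm]
    exact pow_le_pow_left₀ (by positivity) h3 p

/-- A function whose coefficients solve the band system is a weak solution. -/
theorem integral_mul_transpose_eq_zero_of_mem_solutionSpace [CompleteSpace K] {w : ℝ → ℝ}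
    (hw : IsWeight K w) {ι : H →L[ℂ] K} (hι : ∀ f, toAE (ι f) = toAE f)
    {p : ℕ} (P : LinDiffOp (p + 1)) (lam : ℂ) (e : HilbertBasis ℕ ℂ H) (e' : HilbertBasis ℕ ℂ K)
    (hC1 : CondC1 P lam e K) (hC2 : CondC2 (matrixElem P lam e e' hC1))
    (hC21 : CondC21 (p + 1) (matrixElem P lam e e' hC1)) (hC22 : CondC22 (p + 1) e') {f : H}
    (hf : (fun n => inner ℂ (e n) f) ∈ solutionSpace (matrixElem P lam e e' hC1))
    {I : Set ℝ} {φ : ℝ → ℂ} (hφ : IsTestFunction I φ) :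
    ∫ x, (toAE f : ℝ → ℂ) x * (P.shift lam).transpose φ x = 0 := by
  have hφ' := (P.shift lam).isTestFunction_transpose hφ
  obtain ⟨k, hk⟩ := hw.exists_integral_mul_eq_inner hφ.continuous hφ.compact
  obtain ⟨l, hl⟩ := hw.exists_integral_mul_eq_inner hφ'.continuous hφ'.compact
  obtain ⟨ℓ, hband⟩ := hC2.exists_nat
  obtain ⟨c, hc, hb⟩ := hC21.exists_bound
  obtain ⟨α, d, m0, hα, hβ⟩ := hC22.exists_coefficient_bound hw hφ
  set s : ℕ → ℂ := fun n => inner ℂ (e n) f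
  let q : ℕ → H × K := fun n => (e n, opB P lam H K ⟨e n, mem_opB_of_mem_opBTilde P lam (hC1 n)⟩)
  have hq : ∀ n, q n ∈ actionGraph (P.shift lam) H K := fun n => mem_actionGraph_opB P lam (hC1 n)
  -- Partial sums are taken in the graph: the first components tend to `f`, while nothing is claimed
  -- about convergence of the second.
  let Q : ℕ → H × K := fun N => ∑ n ∈ Finset.range N, s n • q n
  have hQ : ∀ N, Q N ∈ actionGraph (P.shift lam) H K := fun N =>
    Submodule.sum_mem _ fun n _ => Submodule.smul_mem _ _ (hq n)
  have hQ1 : Tendsto (fun N => (Q N).1) atTop (𝓝 f) := by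
    have h1 := (e.hasSum_repr f).tendsto_sum_nat
    refine h1.congr fun N => ?_
    simp only [Q, Prod.fst_sum, Prod.smul_fst, q, s, e.repr_apply_apply]
  have hlim : Tendsto (fun N => inner ℂ k (Q N).2) atTop (𝓝 (inner ℂ l (ι f) : ℂ)) := by
    have h1 : ∀ N, (inner ℂ k (Q N).2 : ℂ) = inner ℂ l (ι (Q N).1) := fun N => by
      rw [← hk, ← hl, hι]
      exact integral_mul_eq_of_mem_actionGraph _ (hQ N) hφ
    simp only [h1]
    exact tendsto_const_nhds.inner ((ι.continuous.tendsto f).comp hQ1)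
  have hzero := eq_zero_of_tendsto_truncation (s := s) (p := p) (α := α) (m0 := m0) (d := d)
    (β := fun m => ∫ x, (toAE (e' m) : ℝ → ℂ) x * φ x) hc hband hb
    (e.orthonormal.inner_products_summable f) hf hα hβ (fun N => ?_) hlim
  · rw [← hzero, ← hl, hι]
  -- Parseval in `K` expands the tested partial sum into the truncated row sums.
  · have h1 := e'.hasSum_inner_mul_inner k (Q N).2
    have h2 : (fun m => (∫ x, (toAE (e' m) : ℝ → ℂ) x * φ x) *
        ∑ n ∈ Finset.range N, matrixElem P lam e e' hC1 m n * s n) =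
        fun m => inner ℂ k (e' m) * inner ℂ (e' m) (Q N).2 := by
      funext m
      rw [hk]
      congr 1
      simp only [Q, Prod.snd_sum, Prod.smul_snd, inner_sum, inner_smul_right, q]
      refine Finset.sum_congr rfl fun n _ => ?_
      rw [mul_comm]
      rfl
    rw [h2]
    exact h1

end

/-! ### Assembly of the three implications. -/

theorem mainTheorem4
    (M : ℕ) (hM : 1 ≤ M) (P : LinDiffOp M) (lam : ℂ)
    (H : Type*) [NormedAddCommGroup H] [InnerProductSpace ℂ H] [CompleteSpace H]
    [HilbertFunctionSpace H]
    (K : Type*) [NormedAddCommGroup K] [InnerProductSpace ℂ K] [CompleteSpace K]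
    [HilbertFunctionSpace K]
    (hHK : FunctionSubset H K)
    (e : HilbertBasis ℕ ℂ H) (e' : HilbertBasis ℕ ℂ K)
    (hC1 : CondC1 P lam e K)
    (hC2 : CondC2 (matrixElem P lam e e' hC1))
    (hC2Plus : CondC2Plus M K)
    (hC21 : CondC21 M (matrixElem P lam e e' hC1))
    (hC22 : CondC22 M e')
    (hC23 : CondC23 M e')
    (hC3 : CondC3 P lam H e')
    (f : H) :
    ((∃ hf : f ∈ (opA P H).domain, opA P H ⟨f, hf⟩ = lam • f) →
      (∃ hf : f ∈ (opB P lam H K).domain, opB P lam H K ⟨f, hf⟩ = 0)) ∧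
    ((∃ hf : f ∈ (opB P lam H K).domain, opB P lam H K ⟨f, hf⟩ = 0) →
      ((fun n => inner ℂ (e n) f) ∈ solutionSpace (matrixElem P lam e e' hC1) ∧
        Memℓp (fun n => (inner ℂ (e n) f : ℂ)) 2)) ∧
    (((fun n => inner ℂ (e n) f) ∈ solutionSpace (matrixElem P lam e e' hC1) ∧
        Memℓp (fun n => (inner ℂ (e n) f : ℂ)) 2) →
      (∃ u : ℝ → ℂ, (HilbertFunctionSpace.toAE f : ℝ → ℂ) =ᵐ[volume] u ∧
        ContDiffOn ℝ M u P.singularSetᶜ ∧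
        ∀ x ∈ P.singularSetᶜ, P.act u x = lam * u x)) := by
  obtain ⟨w, hw⟩ := hC2Plus.exists_isWeight
  obtain ⟨ι, hι⟩ := hw.exists_inclusion (H := H) hHK
  obtain ⟨p, rfl⟩ : ∃ p, M = p + 1 := ⟨M - 1, by omega⟩
  refine ⟨fun h => ?_, fun h => ⟨?_, ?_⟩, fun h => ?_⟩
  · rw [LinearPMap.exists_apply_eq_iff_mem_graph] at h ⊢
    simpa using mem_opB_graph_of_mem_opA_graph hw hι P lam h
  · rw [LinearPMap.exists_apply_eq_iff_mem_graph] at h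
    exact mem_solutionSpace_of_mem_opB_graph hw hι P lam e e' hC1 hC3 h
  · have h1 := lp.memℓp (e.repr f)
    exact (funext fun n => e.repr_apply_apply f n : (e.repr f : ℕ → ℂ) = _) ▸ h1
  -- As the order is at least one, subtracting `lam` does not touch the leading coefficient.
  · have hsing : (P.shift lam).singularSet = P.singularSet := by
      ext x
      simp [LinDiffOp.singularSet, LinDiffOp.shift]
    have hloc : LocallyIntegrable (HilbertFunctionSpace.toAE f : ℝ → ℂ) := by
      rw [← hι]
      exact hw.locallyIntegrable _
    obtain ⟨u, hfu, hu, hact⟩ := (P.shift lam).exists_solution_of_weak hM hloc fun φ hφ =>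
      integral_mul_transpose_eq_zero_of_mem_solutionSpace hw hι P lam e e' hC1 hC2 hC21 hC22 h.1 hφ
    rw [hsing] at hu hact
    refine ⟨u, hfu, hu, fun x hx => ?_⟩
    rw [← sub_eq_zero, ← LinDiffOp.act_shift]
    exact hact x hx
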